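/- Let $(G,+)$ be a countably infinite abelian group and let $(X,\mathcal A,\mu,(T_g)_{g\in G})$ be a measure preserving system: $(X,\mathcal A,\mu)$ is a separable probability space (some countable family of measurable sets is dense in $\mathcal A$ for the pseudometric $\mu(A\triangle B)$), and $(T_g)_{g\in G}$ is an action of $G$ on $X$ by measurable maps preserving $\mu$. Let $\ell\in\mathbb N=\{1,2,\dots\}$. Terminology. For an abelian group $H$, a Følner sequence in $H$ is a sequence $(F_k)_{k\in\mathbb N}$ of non-empty finite subsets of $H$ with $\lim_{k\to\infty}|(h+F_k)\cap F_k|/|F_k|=1$ for every $h\in H$; for $E\subseteq H$ put $\overline d_{(F_k)}(E)=\limsup_{k\to\infty}|E\cap F_k|/|F_k|$; and $E$ has uniform density one if $\overline d_{(F_k)}(E)=1$ for every Følner sequence $(F_k)$ in $H$. For a sequence $(g_k)_{k\in\mathbb N}$ in $G$, $\lim_{k\to\infty} g_k=\infty$ means that for every finite $K\subseteq G$ one has $g_k\notin K$ for all large $k$. A sequence $(\mathbf g_k)=(g_{k,1},\dots,g_{k,m})$ in $G^m$ is non-degenerated if $\lim_{k\to\infty} g_{k,t}=\infty$ for each $t$;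 two sequences $(\mathbf g_k),(\mathbf h_k)$ in $G^m$ are essentially distinct if $\lim_{k\to\infty}(g_{k,t}-h_{k,t})=\infty$ for each $t$. Let $\mathbb N^{(m)}$ be the set of $m$-element subsets of $\mathbb N$; for $\alpha=\{k_1<\dots<k_m\}\in\mathbb N^{(m)}$ put $g_\alpha=g_{k_1,1}+g_{k_2,2}+\cdots+g_{k_m,m}$. For real numbers $x_\alpha$ ($\alpha\in\mathbb N^{(m)}$) and $x$, $\mathcal R\text{-}\lim_{\alpha\in\mathbb N^{(m)}}x_\alpha=x$ means that for every $\epsilon>0$ there is $\alpha_0\in\mathbb N^{(m)}$ such that $|x_\alpha-x|<\epsilon$ for all $\alpha\in\mathbb N^{(m)}$ with $\min\alpha>\max\alpha_0$. A sequence $(S_k)_{k\in\mathbb N}$ of measure preserving transformations of $X$ has the mixing property if $\lim_{k\to\infty}\mu(A_0\cap S_k^{-1}A_1)=\mu(A_0)\mu(A_1)$ for all $A_0,A_1\in\mathcal A$. The action $(T_g)$ is weakly mixing if the diagonal action $(T_g\times T_g)_{g\in G}$ on $(X\times X,\mathcal A\otimes\mathcal A,\mu\otimes\mu)$ is ergodic.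 Theorem. The following statements are equivalent: (i) $(T_g)_{g\in G}$ is weakly mixing. (ii) For any Følner sequence $(F_k)_{k\in\mathbb N}$ in $G^\ell$, any $E\subseteq G^\ell$ with $\overline d_{(F_k)}(E)>0$ and any $m\in\mathbb N$, there exist non-degenerated and pairwise essentially distinct sequences $(\mathbf g^{(j)}_k)_{k\in\mathbb N}=(g^{(j)}_{k,1},\dots,g^{(j)}_{k,m})_{k\in\mathbb N}$, $j\in\{1,\dots,\ell\}$, in $G^m$ such that: (a) $\{(g^{(1)}_\alpha,\dots,g^{(\ell)}_\alpha)\mid\alpha\in\mathbb N^{(m)}\}\subseteq E$; (b) for any $t\in\{1,\dots,m\}$ and any $j\in\{1,\dots,\ell\}$, $(T_{g^{(j)}_{k,t}})_{k\in\mathbb N}$ has the mixing property; (c) for any $t\in\{1,\dots,m\}$ and any $i\neq j$ in $\{1,\dots,\ell\}$, $(T_{g^{(j)}_{k,t}-g^{(i)}_{k,t}})_{k\in\mathbb N}$ has the mixing property. (iii) For any Følner sequence $(F_k)_{k\in\mathbb N}$ in $G^\ell$ and any $E\subseteq G^\ell$ with $\overline d_{(F_k)}(E)>0$, there exist $m\in\mathbb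 N$ and sequences $(\mathbf g^{(1)}_k)_{k\in\mathbb N},\dots,(\mathbf g^{(\ell)}_k)_{k\in\mathbb N}$ in $G^m$ with $\{(g^{(1)}_\alpha,\dots,g^{(\ell)}_\alpha)\mid\alpha\in\mathbb N^{(m)}\}\subseteq E$ such that for any $A_0,\dots,A_\ell\in\mathcal A$, $$\mathop{\mathcal R\text{-}\lim}_{\alpha\in\mathbb N^{(m)}}\mu\bigl(A_0\cap T_{g^{(1)}_\alpha}A_1\cap\cdots\cap T_{g^{(\ell)}_\alpha}A_\ell\bigr)=\prod_{j=0}^{\ell}\mu(A_j).$$ (iv) For any $A_0,\dots,A_\ell\in\mathcal A$ and any $\epsilon>0$, the set $$R_\epsilon(A_0,\dots,A_\ell)=\Bigl\{(g_1,\dots,g_\ell)\in G^\ell\;\Big|\;\Bigl|\mu(A_0\cap T_{g_1}A_1\cap\cdots\cap T_{g_\ell}A_\ell)-\prod_{j=0}^{\ell}\mu(A_j)\Bigr|<\epsilon\Bigr\}$$ has uniform density one. -/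

import Mathlib

open MeasureTheory Filter Topology
open scoped Pointwise

noncomputable section

namespace AbelianMixing

section Sequences

variable {G : Type*} [AddCommGroup G]

/-- A sequence of non-empty finite subsets `F k` of a (discrete) abelian group is a Følner sequence
if `|(g + F k) ∩ F k| / |F k| → 1` for every `g`. -/
def IsFolnerSeq (F : ℕ → Finset G) : Prop :=
  (∀ k, (F k).Nonempty) ∧
    ∀ g : G, Tendsto
      (fun k => (((g +ᵥ (F k : Set G)) ∩ (F k : Set G)).ncard : ℝ) / ((F k).card : ℝ)) atTop (𝓝 1)

/-- The upper density of `E` along `(F k)`. -/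
def upperDensity (F : ℕ → Finset G) (E : Set G) : ℝ :=
  limsup (fun k => ((E ∩ (F k : Set G)).ncard : ℝ) / ((F k).card : ℝ)) atTop

/-- `E` has uniform density one if its upper density is one along every Følner sequence. -/
def HasUniformDensityOne (E : Set G) : Prop :=
  ∀ F : ℕ → Finset G, IsFolnerSeq F → upperDensity F E = 1

/-- `lim g k = ∞`: the sequence eventually leaves every finite subset of `G`. -/
def TendsToInfinity (g : ℕ → G) : Prop :=
  Tendsto g atTop cofinite

/-- A sequence in `G ^ m` is non-degenerated if each of its coordinates tends to infinity. -/
def NonDegenerated {m : ℕ} (g : ℕ → Fin m → G) : Prop :=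
  ∀ t : Fin m, TendsToInfinity fun k => g k t

/-- Two sequences in `G ^ m` are essentially distinct if in each coordinate they grow apart. -/
def EssentiallyDistinct {m : ℕ} (g h : ℕ → Fin m → G) : Prop :=
  ∀ t : Fin m, TendsToInfinity fun k => g k t - h k t

/-- For `α = {k₁ < ⋯ < kₘ}`, the element `g_α = g_{k₁,1} + ⋯ + g_{kₘ,m}`. The type
`Set.powersetCard ℕ m` is the family of all `m`-element subsets of `ℕ`. -/
def sumAlong {m : ℕ} (g : ℕ → Fin m → G) (α : Set.powersetCard ℕ m) : G :=
  ∑ t : Fin m, g ((α : Finset ℕ).orderEmbOfFin (Set.powersetCard.card_eq α) t) t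

end Sequences

/-- The `𝓡`-limit of a family indexed by the `m`-element subsets of `ℕ`: for every `ε > 0` there is
an `m`-element set `α₀` such that `x α` is `ε`-close to `a` whenever `min α > max α₀`. -/
def HasRLim {Y : Type*} [PseudoMetricSpace Y] {m : ℕ} (x : Set.powersetCard ℕ m → Y) (a : Y) :
    Prop :=
  ∀ ε : ℝ, 0 < ε → ∃ α₀ : Set.powersetCard ℕ m, ∀ α : Set.powersetCard ℕ m,
    (∀ i ∈ (α₀ : Finset ℕ), ∀ k ∈ (α : Finset ℕ), i < k) → dist (x α) a < ε

section Dynamics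

/-- A sequence of measure preserving maps `T k` has the mixing property if
`μ (A₀ ∩ (T k)⁻¹ A₁) → μ A₀ * μ A₁` for all measurable `A₀`, `A₁`. -/
def MixingProperty {X : Type*} [MeasurableSpace X] (μ : Measure X) (T : ℕ → X → X) : Prop :=
  ∀ A₀ A₁ : Set X, MeasurableSet A₀ → MeasurableSet A₁ →
    Tendsto (fun k => μ.real (A₀ ∩ T k ⁻¹' A₁)) atTop (𝓝 (μ.real A₀ * μ.real A₁))

/-- A measure preserving action is weakly mixing if the diagonal action on the product of the
space with itself is ergodic. -/
def IsWeaklyMixing (G : Type*) {X : Type*} [AddCommGroup G] [AddAction G X] [MeasurableSpace X]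
    (μ : Measure X) : Prop :=
  ErgodicVAdd G (X × X) (μ.prod μ)

variable {G X : Type*} [AddCommGroup G] [AddAction G X] [MeasurableSpace X]

/-- The multicorrelation `μ (A₀ ∩ T_{g₁} A₁ ∩ ⋯ ∩ T_{g_ℓ} A_ℓ)`, where `T_g A = g +ᵥ A`. -/
def multiCorrelation (μ : Measure X) {ℓ : ℕ} (A : Fin (ℓ + 1) → Set X) (g : Fin ℓ → G) : ℝ :=
  μ.real (A 0 ∩ ⋂ j : Fin ℓ, (g j +ᵥ A j.succ))

/-- The set `R_ε(A₀, …, A_ℓ)` of all `g` in `G ^ ℓ` for which the multicorrelation is `ε`-close to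
the product of the measures. -/
def mixingSet (G : Type*) [AddCommGroup G] [AddAction G X] (μ : Measure X) {ℓ : ℕ}
    (A : Fin (ℓ + 1) → Set X) (ε : ℝ) : Set (Fin ℓ → G) :=
  {g | |multiCorrelation μ A g - ∏ j, μ.real (A j)| < ε}

end Dynamics

end AbelianMixing

end

open AbelianMixing

/-! Averages along Følner sequences are replaced by invariant means `Λ` on the bounded functions on
`G ^ ℓ`; the sets of full mean form a filter, `meanFilter`. For an ergodic action the mean of a
multicorrelation is the product of the measures (`map_multiCorrelation`): as a function of one of
the sets, it is finitely additive, invariant and dominated by the measure, hence a multiple of it.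
Weak mixing allows the same computation on `X × X`, where the multicorrelation of squares `A j ×ˢ A
j` is the square of the original one. So the variance vanishes and multicorrelations converge along
`meanFilter` (`IsWeaklyMixing.tendsto_multiCorrelation`). Since `Λ` is arbitrary, this gives (iv).

For (ii) and (iii), positive upper density yields a mean with `Λ (ind E) > 0`. By separability
mixing need only be tested on a countable dense family, so it is convergence along a countably
generated filter, and sequences can be drawn from a decreasing base of sets of full mean. This gives
(iii), already with `m = 1`. For (ii), `Λ` is replaced by an extreme invariant mean, which behaves
like an ergodic measure: by `IsExtremeMean.shiftMean_eq` the average over `g` of `Λ (B ∩ (A - g))`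
is `Λ B * Λ A`. Shifts taken from sets of full mean can therefore keep intersections of positive
mean, and iterating `m` times places all the sums in `E`.

Conversely, each of (ii), (iii), (iv) makes pairs of sets mix along some proper filter. This passes
to `X × X` by a π-λ argument, and an invariant set `S` must then satisfy `ν S = ν S ^ 2`. -/

namespace AbelianMixing

/-! ### Invariant means and their filters of full-mean sets -/

section Means

/-- A real function is bounded in absolute value. -/
def BddFun {H : Type*} (f : H → ℝ) : Prop := ∃ C, ∀ x, |f x| ≤ C

namespace BddFun
variable {H H' : Type*} {f g : H → ℝ}

theorem add (hf : BddFun f) (hg : BddFun g) : BddFun (f + g) := by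
  obtain ⟨C, hC⟩ := hf
  obtain ⟨D, hD⟩ := hg
  exact ⟨C + D, fun x => (abs_add_le _ _).trans (add_le_add (hC x) (hD x))⟩

theorem smul (c : ℝ) (hf : BddFun f) : BddFun (c • f) := by
  obtain ⟨C, hC⟩ := hf
  refine ⟨|c| * C, fun x => ?_⟩
  simp only [Pi.smul_apply, smul_eq_mul, abs_mul]
  exact mul_le_mul_of_nonneg_left (hC x) (abs_nonneg c)

theorem sub (hf : BddFun f) (hg : BddFun g) : BddFun (f - g) := by
  have := hf.add (hg.smul (-1))
  simpa [sub_eq_add_neg] using this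

theorem mul (hf : BddFun f) (hg : BddFun g) : BddFun (f * g) := by
  obtain ⟨C, hC⟩ := hf
  obtain ⟨D, hD⟩ := hg
  refine ⟨C * D, fun x => ?_⟩
  simp only [Pi.mul_apply, abs_mul]
  exact mul_le_mul (hC x) (hD x) (abs_nonneg _) ((abs_nonneg _).trans (hC x))

theorem comp (hf : BddFun f) (φ : H' → H) : BddFun (fun x => f (φ x)) := by
  obtain ⟨C, hC⟩ := hf
  exact ⟨C, fun x => hC _⟩

theorem const (c : ℝ) : BddFun (fun _ : H => c) := ⟨|c|, fun _ => le_rfl⟩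

theorem of_mem_Icc (h0 : ∀ x, 0 ≤ f x) (h1 : ∀ x, f x ≤ 1) : BddFun f :=
  ⟨1, fun x => abs_le.2 ⟨by linarith [h0 x], h1 x⟩⟩

theorem sum {ι : Type*} (s : Finset ι) (F : ι → H → ℝ) (h : ∀ i ∈ s, BddFun (F i)) :
    BddFun (fun x => ∑ i ∈ s, F i x) := by
  classical
  induction s using Finset.induction_on with
  | empty => simpa using const 0
  | insert a s ha ih =>
    simp only [Finset.sum_insert ha]
    exact (h a (by simp)).add (ih fun i hi => h i (by simp [hi]))

end BddFun

/-- The `0`-`1` valued indicator function of a set. -/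
noncomputable def ind {H : Type*} (S : Set H) : H → ℝ := S.indicator fun _ => 1

section Ind
variable {H : Type*}

theorem ind_nonneg (S : Set H) (x : H) : 0 ≤ ind S x :=
  Set.indicator_nonneg (fun _ _ => zero_le_one) x

theorem ind_le_one (S : Set H) (x : H) : ind S x ≤ 1 :=
  Set.indicator_le_self' (fun _ _ => zero_le_one) x

theorem bddFun_ind (S : Set H) : BddFun (ind S) := .of_mem_Icc (ind_nonneg S) (ind_le_one S)

theorem ind_of_mem {S : Set H} {x : H} (h : x ∈ S) : ind S x = 1 := Set.indicator_of_mem h _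

theorem ind_of_notMem {S : Set H} {x : H} (h : x ∉ S) : ind S x = 0 := Set.indicator_of_notMem h _

theorem ind_univ : ind (Set.univ : Set H) = fun _ => 1 := Set.indicator_univ _

theorem ind_empty : ind (∅ : Set H) = fun _ => 0 := Set.indicator_empty _

theorem ind_mono {S T : Set H} (h : S ⊆ T) (x : H) : ind S x ≤ ind T x :=
  Set.indicator_le_indicator_of_subset h (fun _ => zero_le_one) x

theorem ind_inter (S T : Set H) (x : H) : ind (S ∩ T) x = ind S x * ind T x := by
  by_cases hS : x ∈ S <;> by_cases hT : x ∈ T <;> simp [ind, hS, hT]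

theorem ind_compl (S : Set H) (x : H) : ind Sᶜ x = 1 - ind S x := by
  by_cases hS : x ∈ S <;> simp [ind, hS]

theorem ind_union_le (S T : Set H) (x : H) : ind (S ∪ T) x ≤ ind S x + ind T x := by
  by_cases hS : x ∈ S <;> by_cases hT : x ∈ T <;> simp [ind, hS, hT]

end Ind

variable {H : Type*} [AddCommGroup H]

/-- An invariant mean on the bounded real functions on an abelian group, extended by zero to
unbounded functions. -/
structure IsInvMean (Λ : (H → ℝ) → ℝ) : Prop where
  map_add : ∀ f g, BddFun f → BddFun g → Λ (f + g) = Λ f + Λ g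
  map_smul : ∀ (c : ℝ) f, BddFun f → Λ (c • f) = c * Λ f
  le_of_forall_le : ∀ f C, BddFun f → (∀ x, f x ≤ C) → Λ f ≤ C
  map_shift : ∀ f h, BddFun f → Λ (fun x => f (x + h)) = Λ f
  map_unbdd : ∀ f, ¬ BddFun f → Λ f = 0

namespace IsInvMean
variable {Λ : (H → ℝ) → ℝ} (hΛ : IsInvMean Λ) {f g : H → ℝ}
include hΛ

theorem map_sub (hf : BddFun f) (hg : BddFun g) : Λ (f - g) = Λ f - Λ g := by
  have h := hΛ.map_add f ((-1 : ℝ) • g) hf (hg.smul _)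
  rw [hΛ.map_smul _ _ hg] at h
  rw [show f - g = f + (-1 : ℝ) • g by simp [sub_eq_add_neg], h]
  ring

theorem mono (hf : BddFun f) (hg : BddFun g) (h : ∀ x, f x ≤ g x) : Λ f ≤ Λ g := by
  have := hΛ.le_of_forall_le (f - g) 0 (hf.sub hg) (fun x => by simpa using h x)
  rw [hΛ.map_sub hf hg] at this
  linarith

theorem map_const (c : ℝ) : Λ (fun _ => c) = c := by
  apply le_antisymm (hΛ.le_of_forall_le _ _ (.const c) fun _ => le_rfl)
  have h := hΛ.le_of_forall_le ((-1 : ℝ) • fun _ => c) (-c) ((BddFun.const c).smul _)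
    (fun x => by simp)
  rw [hΛ.map_smul _ _ (.const c)] at h
  linarith

theorem nonneg (h : ∀ x, 0 ≤ f x) : 0 ≤ Λ f := by
  by_cases hf : BddFun f
  · simpa [hΛ.map_const] using hΛ.mono (.const 0) hf h
  · rw [hΛ.map_unbdd f hf]

theorem map_sum {ι : Type*} (s : Finset ι) (F : ι → H → ℝ) (h : ∀ i ∈ s, BddFun (F i)) :
    Λ (fun x => ∑ i ∈ s, F i x) = ∑ i ∈ s, Λ (F i) := by
  classical
  induction s using Finset.induction_on with
  | empty => simpa using hΛ.map_const 0
  | insert a s ha ih =>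
    simp only [Finset.sum_insert ha]
    rw [← ih fun i hi => h i (by simp [hi])]
    exact hΛ.map_add (F a) _ (h a (by simp)) (.sum s F fun i hi => h i (by simp [hi]))

theorem ind_eq_zero_mono {S T : Set H} (h : S ⊆ T) (hT : Λ (ind T) = 0) : Λ (ind S) = 0 :=
  le_antisymm (hT ▸ hΛ.mono (bddFun_ind _) (bddFun_ind _) (ind_mono h))
    (hΛ.nonneg (ind_nonneg S))

theorem map_ind_compl (S : Set H) : Λ (ind Sᶜ) = 1 - Λ (ind S) := by
  rw [show ind Sᶜ = (fun _ => (1 : ℝ)) - ind S from funext (ind_compl S),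
    hΛ.map_sub (.const 1) (bddFun_ind S), hΛ.map_const]

/-- The filter of sets of full mean. -/
def meanFilter : Filter H where
  sets := {D | Λ (ind Dᶜ) = 0}
  univ_sets := by simp [ind_empty, hΛ.map_const]
  sets_of_superset := fun hD hDD' => hΛ.ind_eq_zero_mono (Set.compl_subset_compl.2 hDD') hD
  inter_sets := by
    intro D D' hD hD'
    refine le_antisymm ?_ (hΛ.nonneg (ind_nonneg _))
    have := hΛ.mono (bddFun_ind (D ∩ D')ᶜ) ((bddFun_ind Dᶜ).add (bddFun_ind D'ᶜ))
      (by rw [Set.compl_inter]; exact ind_union_le _ _)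
    rw [hΛ.map_add _ _ (bddFun_ind _) (bddFun_ind _)] at this
    have hD1 : Λ (ind Dᶜ) = 0 := hD
    have hD2 : Λ (ind D'ᶜ) = 0 := hD'
    linarith

theorem mem_meanFilter {D : Set H} : D ∈ hΛ.meanFilter ↔ Λ (ind Dᶜ) = 0 := Iff.rfl

instance neBot_meanFilter : hΛ.meanFilter.NeBot := by
  refine ⟨fun h => ?_⟩
  have := hΛ.mem_meanFilter.1 (h ▸ mem_bot : (∅ : Set H) ∈ hΛ.meanFilter)
  rw [Set.compl_empty, ind_univ, hΛ.map_const] at this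
  exact one_ne_zero this

/-- Chebyshev's inequality: `ε ^ 2` times the indicator of the bad set is at most `(f - a) ^ 2`. -/
theorem tendsto_of_sq {a : ℝ} (hf : BddFun f) (h : Λ (fun x => (f x - a) ^ 2) = 0) :
    Tendsto f hΛ.meanFilter (𝓝 a) := by
  rw [Metric.tendsto_nhds]
  intro ε hε
  rw [Filter.Eventually, mem_meanFilter]
  refine le_antisymm ?_ (hΛ.nonneg (ind_nonneg _))
  have hb : BddFun (fun x => (f x - a) ^ 2) := by
    have h1 : BddFun (f - fun _ => a) := hf.sub (.const a)
    simpa [pow_two] using! h1.mul h1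
  have key := hΛ.mono ((bddFun_ind {x | dist (f x) a < ε}ᶜ).smul (ε ^ 2)) hb (fun x => by
    by_cases hx : dist (f x) a < ε
    · rw [Pi.smul_apply, ind_of_notMem (by simpa using hx)]
      simpa using sq_nonneg _
    · rw [Pi.smul_apply, ind_of_mem (by simpa using hx), smul_eq_mul, mul_one,
        ← sq_abs (f x - a)]
      rw [Real.dist_eq, not_lt] at hx
      gcongr)
  rw [hΛ.map_smul _ _ (bddFun_ind _), h] at key
  exact nonpos_of_mul_nonpos_right key (by positivity)

theorem comp {H' : Type*} [AddCommGroup H'] (φ : H →+ H') (hφ : Function.Surjective φ) :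
    IsInvMean (fun f : H' → ℝ => Λ (fun x => f (φ x))) where
  map_add f g hf hg := hΛ.map_add _ _ (hf.comp φ) (hg.comp φ)
  map_smul c f hf := hΛ.map_smul c _ (hf.comp φ)
  le_of_forall_le f C hf h := hΛ.le_of_forall_le _ C (hf.comp φ) fun x => h _
  map_shift f h hf := by
    obtain ⟨y, rfl⟩ := hφ h
    simpa using hΛ.map_shift _ y (hf.comp φ)
  map_unbdd f hf := hΛ.map_unbdd _ fun ⟨C, hC⟩ => hf ⟨C, fun x => by
    obtain ⟨y, rfl⟩ := hφ x
    exact hC y⟩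

theorem tendsto_comp {H' : Type*} [AddCommGroup H'] (φ : H →+ H')
    (hφ : Function.Surjective φ) : Tendsto φ hΛ.meanFilter (hΛ.comp φ hφ).meanFilter :=
  fun _ hD => hD

/-- Distinct translates of a point are disjoint and have equal mean, so `n` of them give `n * Λ (ind
{a}) ≤ 1` for every `n`; hence points are null. -/
theorem meanFilter_le_cofinite [Infinite H] : hΛ.meanFilter ≤ cofinite := by
  rw [le_cofinite_iff_compl_singleton_mem]
  intro a
  rw [mem_meanFilter, compl_compl]
  have hpos := hΛ.nonneg (ind_nonneg {a})
  by_contra hne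
  obtain ⟨n, hn⟩ := exists_nat_gt (1 / Λ (ind {a}))
  have hlt : 0 < Λ (ind {a}) := lt_of_le_of_ne hpos (Ne.symm hne)
  rw [div_lt_iff₀ hlt] at hn
  let e := Infinite.natEmbedding H
  have h1 : Λ (fun x => ∑ i ∈ Finset.range n, ind {a} (x + e i)) = n * Λ (ind {a}) := by
    rw [hΛ.map_sum _ _ fun i _ => (bddFun_ind {a}).comp _]
    simp [hΛ.map_shift _ _ (bddFun_ind {a})]
  have h2 : Λ (fun x => ∑ i ∈ Finset.range n, ind {a} (x + e i)) ≤ 1 := by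
    refine hΛ.le_of_forall_le _ 1 (.sum _ _ fun i _ => (bddFun_ind {a}).comp _) fun x => ?_
    by_cases hx : ∃ i ∈ Finset.range n, x + e i = a
    · obtain ⟨i, hi, hxi⟩ := hx
      rw [Finset.sum_eq_single_of_mem i hi]
      · exact ind_le_one _ _
      · intro j _ hj
        refine ind_of_notMem fun h => hj (e.injective ?_)
        have : x + e j = a := h
        exact add_left_cancel (this.trans hxi.symm)
    · push Not at hx
      rw [Finset.sum_eq_zero fun i hi => ind_of_notMem (S := {a}) (hx i hi)]
      exact zero_le_one
  linarith

end IsInvMean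

/-! ### Extreme invariant means -/

theorem isCompact_setOf_isInvMean : IsCompact {Λ : (H → ℝ) → ℝ | IsInvMean Λ} := by
  classical
  -- Tychonoff: a mean lies in a product of compact intervals. The value zero on unbounded functions
  -- confines those coordinates, which would otherwise be free and would rule out extreme points.
  let B : (H → ℝ) → ℝ := fun f => if h : BddFun f then h.choose else 0
  have hK : IsCompact (Set.pi Set.univ fun f : H → ℝ => Set.Icc (-B f) (B f)) :=
    isCompact_univ_pi fun f => isCompact_Icc
  refine hK.of_isClosed_subset ?_ ?_
  · have h : {Λ : (H → ℝ) → ℝ | IsInvMean Λ} =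
        (⋂ f, ⋂ g, ⋂ (_ : BddFun f), ⋂ (_ : BddFun g), {Λ | Λ (f + g) = Λ f + Λ g}) ∩
        (⋂ c : ℝ, ⋂ f, ⋂ (_ : BddFun f), {Λ | Λ (c • f) = c * Λ f}) ∩
        (⋂ f, ⋂ C, ⋂ (_ : BddFun f), ⋂ (_ : ∀ x, f x ≤ C), {Λ | Λ f ≤ C}) ∩
        (⋂ f, ⋂ h : H, ⋂ (_ : BddFun f), {Λ | Λ (fun x => f (x + h)) = Λ f}) ∩
        (⋂ f, ⋂ (_ : ¬ BddFun f), {Λ | Λ f = 0}) := by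
      ext Λ
      simp only [Set.mem_inter_iff, Set.mem_iInter, Set.mem_ofPred_eq]
      exact ⟨fun ⟨a, b, c, d, e⟩ => ⟨⟨⟨⟨a, b⟩, c⟩, d⟩, e⟩,
        fun ⟨⟨⟨⟨a, b⟩, c⟩, d⟩, e⟩ => ⟨a, b, c, d, e⟩⟩
    rw [h]
    refine ((((?_ : IsClosed _).inter ?_).inter ?_).inter ?_).inter ?_
    · exact isClosed_iInter fun f => isClosed_iInter fun g => isClosed_iInter fun _ =>
        isClosed_iInter fun _ => isClosed_eq (by fun_prop) (by fun_prop)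
    · exact isClosed_iInter fun c => isClosed_iInter fun g => isClosed_iInter fun _ =>
        isClosed_eq (by fun_prop) (by fun_prop)
    · exact isClosed_iInter fun f => isClosed_iInter fun g => isClosed_iInter fun _ =>
        isClosed_iInter fun _ => isClosed_le (by fun_prop) (by fun_prop)
    · exact isClosed_iInter fun f => isClosed_iInter fun g => isClosed_iInter fun _ =>
        isClosed_eq (by fun_prop) (by fun_prop)
    · exact isClosed_iInter fun f => isClosed_iInter fun _ =>
        isClosed_eq (by fun_prop) (by fun_prop)
  · intro Λ hΛ f _
    have hΛ : IsInvMean Λ := hΛ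
    by_cases hf : BddFun f
    · simp only [B, hf, dif_pos]
      have hC := hf.choose_spec
      refine ⟨?_, hΛ.le_of_forall_le _ _ hf fun x => (le_abs_self _).trans (hC x)⟩
      rw [← hΛ.map_const (-hf.choose)]
      exact hΛ.mono (.const _) hf fun x => (abs_le.1 (hC x)).1
    · simp [B, hf, hΛ.map_unbdd f hf]

/-- An invariant mean that is an extreme point of the set of invariant means. -/
def IsExtremeMean (Λ : (H → ℝ) → ℝ) : Prop :=
  Λ ∈ Set.extremePoints ℝ {Λ : (H → ℝ) → ℝ | IsInvMean Λ}

theorem IsExtremeMean.isInvMean {Λ : (H → ℝ) → ℝ} (h : IsExtremeMean Λ) : IsInvMean Λ := h.1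

/-- The maximizers of the evaluation at `f` form a nonempty compact face of the set of invariant
means, and an extreme point of a face is extreme in the whole set. -/
theorem exists_isExtremeMean_le {Λ : (H → ℝ) → ℝ} (hΛ : IsInvMean Λ) (f : H → ℝ) :
    ∃ Λ' : (H → ℝ) → ℝ, IsExtremeMean Λ' ∧ Λ f ≤ Λ' f := by
  let K := {Λ : (H → ℝ) → ℝ | IsInvMean Λ}
  have hcont : Continuous fun M : (H → ℝ) → ℝ => M f := continuous_apply f
  obtain ⟨M, hM, hmax⟩ := isCompact_setOf_isInvMean.exists_isMaxOn ⟨Λ, hΛ⟩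
    (hcont.continuousOn (s := K))
  let K' := {N ∈ K | N f = M f}
  have hK' : IsCompact K' := by
    have : K' = K ∩ {N | N f = M f} := rfl
    rw [this]
    exact isCompact_setOf_isInvMean.inter_right (isClosed_eq hcont continuous_const)
  obtain ⟨N, hN⟩ := hK'.extremePoints_nonempty ⟨M, hM, rfl⟩
  have hext : IsExtreme ℝ K K' := by
    refine ⟨fun N hN => hN.1, ?_⟩
    rintro N₁ hN₁ N₂ hN₂ N hN ⟨a, b, ha, hb, hab, rfl⟩
    refine ⟨hN₁, ?_⟩
    have h1 : N₁ f ≤ M f := hmax hN₁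
    have h2 : N₂ f ≤ M f := hmax hN₂
    have h3 : a * N₁ f + b * N₂ f = M f := hN.2
    by_contra hne
    have h4 : N₁ f < M f := lt_of_le_of_ne h1 hne
    have : a * N₁ f + b * N₂ f < a * M f + b * M f :=
      add_lt_add_of_lt_of_le (mul_lt_mul_of_pos_left h4 ha) (mul_le_mul_of_nonneg_left h2 hb.le)
    rw [← add_mul, hab, one_mul] at this
    linarith
  refine ⟨N, hext.extremePoints_subset_extremePoints hN, ?_⟩
  rw [(extremePoints_subset hN).2]
  exact hmax hΛ

/-- For a set `B` and an invariant mean `Λ`, the functional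
`f ↦ Λ_g Λ_x (1_B(x) f(x + g))`. -/
noncomputable def shiftMean (Λ : (H → ℝ) → ℝ) (B : Set H) (f : H → ℝ) : ℝ :=
  Λ fun g => Λ fun x => ind B x * f (x + g)

section ShiftMean
variable {Λ : (H → ℝ) → ℝ} (hΛ : IsInvMean Λ) (B : Set H) {f : H → ℝ}

theorem bddFun_ind_mul (hf : BddFun f) (g : H) : BddFun fun x => ind B x * f (x + g) :=
  (bddFun_ind B).mul (hf.comp fun x => x + g)

include hΛ

theorem bddFun_inner (hf : BddFun f) : BddFun fun g => Λ fun x => ind B x * f (x + g) := by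
  obtain ⟨C, hC⟩ := hf
  have hC0 : 0 ≤ C := (abs_nonneg _).trans (hC 0)
  have hb : ∀ g x, |ind B x * f (x + g)| ≤ C := fun g x => by
    rw [abs_mul, abs_of_nonneg (ind_nonneg B x)]
    exact (mul_le_mul (ind_le_one B x) (hC _) (abs_nonneg _) zero_le_one).trans (by simp)
  refine ⟨C, fun g => abs_le.2 ⟨?_, ?_⟩⟩
  · rw [← hΛ.map_const (-C)]
    exact hΛ.mono (.const _) (bddFun_ind_mul B ⟨C, hC⟩ g) fun x => (abs_le.1 (hb g x)).1
  · exact hΛ.le_of_forall_le _ _ (bddFun_ind_mul B ⟨C, hC⟩ g) fun x => (abs_le.1 (hb g x)).2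

theorem shiftMean_add {f g : H → ℝ} (hf : BddFun f) (hg : BddFun g) :
    shiftMean Λ B (f + g) = shiftMean Λ B f + shiftMean Λ B g := by
  unfold shiftMean
  rw [← hΛ.map_add _ _ (bddFun_inner hΛ B hf) (bddFun_inner hΛ B hg)]
  congr 1
  funext y
  rw [Pi.add_apply, ← hΛ.map_add _ _ (bddFun_ind_mul B hf y) (bddFun_ind_mul B hg y)]
  congr 1
  funext x
  simp [mul_add]

theorem shiftMean_smul (c : ℝ) (hf : BddFun f) :
    shiftMean Λ B (c • f) = c * shiftMean Λ B f := by
  unfold shiftMean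
  rw [← hΛ.map_smul _ _ (bddFun_inner hΛ B hf)]
  congr 1
  funext y
  rw [Pi.smul_apply, smul_eq_mul, ← hΛ.map_smul _ _ (bddFun_ind_mul B hf y)]
  congr 1
  funext x
  simp only [Pi.smul_apply, smul_eq_mul]
  ring

theorem shiftMean_mono {f g : H → ℝ} (hf : BddFun f) (hg : BddFun g) (h : ∀ x, f x ≤ g x) :
    shiftMean Λ B f ≤ shiftMean Λ B g :=
  hΛ.mono (bddFun_inner hΛ B hf) (bddFun_inner hΛ B hg) fun y =>
    hΛ.mono (bddFun_ind_mul B hf y) (bddFun_ind_mul B hg y) fun x =>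
      mul_le_mul_of_nonneg_left (h _) (ind_nonneg B x)

theorem shiftMean_const (c : ℝ) : shiftMean Λ B (fun _ => c) = c * Λ (ind B) := by
  unfold shiftMean
  rw [hΛ.map_const, ← hΛ.map_smul _ _ (bddFun_ind B)]
  congr 1
  funext x
  simp [mul_comm]

theorem shiftMean_shift (h : H) (hf : BddFun f) :
    shiftMean Λ B (fun x => f (x + h)) = shiftMean Λ B f := by
  unfold shiftMean
  rw [← hΛ.map_shift _ h (bddFun_inner hΛ B hf)]
  simp only [add_assoc]

/-- The two indicators add up to `1`, and the inner mean of `f (x + y)` is `Λ f` for every `y`. -/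
theorem shiftMean_add_compl (hf : BddFun f) : shiftMean Λ B f + shiftMean Λ Bᶜ f = Λ f := by
  unfold shiftMean
  rw [← hΛ.map_add _ _ (bddFun_inner hΛ B hf) (bddFun_inner hΛ Bᶜ hf), ← hΛ.map_const (Λ f)]
  congr 1
  funext y
  rw [Pi.add_apply, ← hΛ.map_add _ _ (bddFun_ind_mul B hf y) (bddFun_ind_mul Bᶜ hf y),
    ← hΛ.map_shift f y hf]
  congr 1
  funext x
  simp only [Pi.add_apply, ind_compl]
  ring

open Classical in
theorem isInvMean_shiftMean (hB : 0 < Λ (ind B)) :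
    IsInvMean (fun f => if BddFun f then (Λ (ind B))⁻¹ * shiftMean Λ B f else 0) where
  map_add f g hf hg := by
    simp only [hf, hg, hf.add hg, if_true, shiftMean_add hΛ B hf hg, mul_add]
  map_smul c f hf := by
    simp only [hf, hf.smul c, if_true, shiftMean_smul hΛ B c hf]
    ring
  le_of_forall_le f C hf h := by
    simp only [hf, if_true]
    rw [inv_mul_le_iff₀ hB, mul_comm, ← shiftMean_const hΛ]
    exact shiftMean_mono hΛ B hf (.const C) h
  map_shift f h hf := by
    simp only [hf, hf.comp (fun x => x + h), if_true, shiftMean_shift hΛ B h hf]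
  map_unbdd f hf := by simp only [hf, if_false]

end ShiftMean

/-- After normalization, the functionals `shiftMean Λ B` and `shiftMean Λ Bᶜ` are invariant means
whose convex combination with weights `Λ (ind B)`, `Λ (ind Bᶜ)` is `Λ`; extremality forces both to
equal `Λ`. If `Bᶜ` is null, its part cannot be normalized but contributes zero. -/
theorem IsExtremeMean.shiftMean_eq {Λ : (H → ℝ) → ℝ} (hext : IsExtremeMean Λ) (B : Set H)
    (hB : 0 < Λ (ind B)) {f : H → ℝ} (hf : BddFun f) : shiftMean Λ B f = Λ (ind B) * Λ f := by
  classical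
  have hΛ := hext.isInvMean
  have hc := hΛ.map_ind_compl B
  rcases (hΛ.nonneg (ind_nonneg Bᶜ)).eq_or_lt with h0 | hpos
  · have h1 : Λ (ind B) = 1 := by linarith
    have h2 : shiftMean Λ Bᶜ f = 0 := by
      have hzero : ∀ y, (Λ fun x => ind Bᶜ x * f (x + y)) = 0 := fun y => by
        obtain ⟨C, hC⟩ := hf
        have hb := bddFun_ind_mul Bᶜ ⟨C, hC⟩ y
        apply le_antisymm
        · have := hΛ.mono hb ((bddFun_ind Bᶜ).smul C) fun x => by
            simp only [Pi.smul_apply, smul_eq_mul]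
            rw [mul_comm]
            exact mul_le_mul_of_nonneg_right (abs_le.1 (hC _)).2 (ind_nonneg _ _)
          rw [hΛ.map_smul _ _ (bddFun_ind _), ← h0] at this
          linarith
        · have := hΛ.mono ((bddFun_ind Bᶜ).smul (-C)) hb fun x => by
            simp only [Pi.smul_apply, smul_eq_mul]
            rw [mul_comm (ind _ _)]
            exact mul_le_mul_of_nonneg_right (abs_le.1 (hC _)).1 (ind_nonneg _ _)
          rw [hΛ.map_smul _ _ (bddFun_ind _), ← h0] at this
          linarith
      unfold shiftMean
      simp only [hzero]
      exact hΛ.map_const 0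
    have := shiftMean_add_compl hΛ B hf
    rw [h1, one_mul]
    linarith
  · have hm := (mem_extremePoints.1 hext).2 _ (isInvMean_shiftMean hΛ B hB) _
      (isInvMean_shiftMean hΛ Bᶜ hpos) ⟨Λ (ind B), Λ (ind Bᶜ), hB, hpos, by linarith, ?_⟩
    · have := congrFun hm.1 f
      simp only [hf, if_true] at this
      rw [← this, mul_inv_cancel_left₀ hB.ne']
    · funext f
      simp only [Pi.add_apply, Pi.smul_apply, smul_eq_mul]
      by_cases hf : BddFun f
      · simp only [hf, if_true]
        rw [mul_inv_cancel_left₀ hB.ne', mul_inv_cancel_left₀ hpos.ne', shiftMean_add_compl hΛ B hf]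
      · simp [hf, hΛ.map_unbdd f hf]

/-- The average over `g` of the mean of the intersection is `Λ (ind B) * Λ (ind A) > 0`, and the
null set of `g` outside `D` does not contribute to it. -/
theorem IsExtremeMean.exists_mem_pos {Λ : (H → ℝ) → ℝ} (hext : IsExtremeMean Λ) {A B D : Set H}
    (hA : 0 < Λ (ind A)) (hB : 0 < Λ (ind B)) (hD : D ∈ hext.isInvMean.meanFilter) :
    ∃ g ∈ D, 0 < Λ (ind (B ∩ {x | x + g ∈ A})) := by
  have hΛ := hext.isInvMean
  by_contra! hcon
  have hle := hΛ.mono (bddFun_inner hΛ B (bddFun_ind A)) (bddFun_ind Dᶜ) fun g => by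
    by_cases hg : g ∈ D
    · rw [ind_of_notMem (by simpa using hg)]
      refine le_trans (le_of_eq ?_) (hcon g hg)
      congr 1
      funext x
      exact (ind_inter B {x | x + g ∈ A} x).symm
    · rw [ind_of_mem hg]
      refine hΛ.le_of_forall_le _ _ (bddFun_ind_mul B (bddFun_ind A) g) fun x => ?_
      exact mul_le_one₀ (ind_le_one _ _) (ind_nonneg _ _) (ind_le_one _ _)
  have h2 := hext.shiftMean_eq B hB (bddFun_ind A)
  have h3 : Λ (ind Dᶜ) = 0 := hD
  have : shiftMean Λ B (ind A) ≤ 0 := h3 ▸ hle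
  have := mul_pos hB hA
  linarith

/-- Shifts can be chosen in prescribed sets of full mean so that all finite
intersections of the shifted sets keep positive mean. -/
theorem IsExtremeMean.exists_seq_inter_pos {Λ : (H → ℝ) → ℝ} (hext : IsExtremeMean Λ)
    {S D : ℕ → Set H} (hS : ∀ k, 0 < Λ (ind (S k))) (hD : ∀ k, D k ∈ hext.isInvMean.meanFilter) :
    ∃ h : ℕ → H, (∀ k, h k ∈ D k) ∧ ∀ N, 0 < Λ (ind {x | ∀ k < N, x + h k ∈ S k}) := by
  have hΛ := hext.isInvMean
  choose! c hcD hcpos using fun (k : ℕ) (B : Set H) (hB : 0 < Λ (ind B)) =>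
    hext.exists_mem_pos (hS k) hB (hD k)
  -- The running intersection: `c k B` is a shift from `D k` that keeps the mean of the next
  -- intersection positive.
  let B : ℕ → Set H := fun n => n.rec Set.univ fun k B => B ∩ {x | x + c k B ∈ S k}
  have hB : ∀ n, 0 < Λ (ind (B n)) := by
    intro n
    induction n with
    | zero =>
      change 0 < Λ (ind Set.univ)
      rw [ind_univ, hΛ.map_const]
      exact one_pos
    | succ k ih => exact hcpos k (B k) ih
  refine ⟨fun k => c k (B k), fun k => hcD k _ (hB k), fun N => ?_⟩
  have : B N = {x | ∀ k < N, x + c k (B k) ∈ S k} := by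
    induction N with
    | zero => simp [B]
    | succ k ih =>
      change B k ∩ {x | x + c k (B k) ∈ S k} = _
      nth_rewrite 1 [ih]
      ext x
      simp only [Set.mem_inter_iff, Set.mem_ofPred_eq, Nat.lt_succ_iff_lt_or_eq]
      constructor
      · rintro ⟨h1, h2⟩ j (hj | rfl)
        exacts [h1 j hj, h2]
      · exact fun h => ⟨fun j hj => h j (Or.inl hj), h k (Or.inr rfl)⟩
  rw [← this]
  exact hB N

end Means
-- Means from Følner sequences, and density
section Folner

variable {H : Type*}

/-- The average of a function over a finite set. -/
noncomputable def avg (F : Finset H) (f : H → ℝ) : ℝ := (∑ x ∈ F, f x) / F.card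

theorem avg_le {F : Finset H} (hF : F.Nonempty) {f : H → ℝ} {C : ℝ} (h : ∀ x, f x ≤ C) :
    avg F f ≤ C := by
  unfold avg
  rw [div_le_iff₀ (by exact_mod_cast hF.card_pos), mul_comm, ← nsmul_eq_mul]
  exact Finset.sum_le_card_nsmul _ _ _ fun x _ => h x

theorem le_avg {F : Finset H} (hF : F.Nonempty) {f : H → ℝ} {C : ℝ} (h : ∀ x, C ≤ f x) :
    C ≤ avg F f := by
  unfold avg
  rw [le_div_iff₀ (by exact_mod_cast hF.card_pos), mul_comm, ← nsmul_eq_mul]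
  exact Finset.card_nsmul_le_sum _ _ _ fun x _ => h x

theorem avg_ind (F : Finset H) (E : Set H) :
    avg F (ind E) = ((E ∩ (F : Set H)).ncard : ℝ) / F.card := by
  classical
  unfold avg
  congr 1
  have h : E ∩ (F : Set H) = ((F.filter (· ∈ E) : Finset H) : Set H) := by
    ext x
    simp [and_comm]
  rw [h, Set.ncard_coe_finset, Finset.card_filter]
  push_cast
  refine Finset.sum_congr rfl fun x _ => ?_
  by_cases hx : x ∈ E <;> simp [ind, hx]

theorem dens_mem_Icc (F : ℕ → Finset H) (E : Set H) (k : ℕ) :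
    ((E ∩ (F k : Set H)).ncard : ℝ) / (F k).card ∈ Set.Icc (0 : ℝ) 1 := by
  refine ⟨by positivity, div_le_one_of_le₀ ?_ (by positivity)⟩
  rw [← Set.ncard_coe_finset (F k)]
  exact_mod_cast Set.ncard_le_ncard Set.inter_subset_right (F k).finite_toSet

theorem isBoundedUnder_dens (F : ℕ → Finset H) (E : Set H) :
    IsBoundedUnder (· ≤ ·) atTop fun k => ((E ∩ (F k : Set H)).ncard : ℝ) / (F k).card :=
  isBoundedUnder_of ⟨1, fun k => (dens_mem_Icc F E k).2⟩

theorem isCoboundedUnder_dens (F : ℕ → Finset H) (E : Set H) :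
    IsCoboundedUnder (· ≤ ·) atTop fun k => ((E ∩ (F k : Set H)).ncard : ℝ) / (F k).card :=
  (isBoundedUnder_of ⟨0, fun k => (dens_mem_Icc F E k).1⟩ :
    IsBoundedUnder (· ≥ ·) atTop _).isCoboundedUnder_le

open Classical in
/-- The limit along an ultrafilter of the averages over a sequence of finite sets. -/
noncomputable def folnerMean (F : ℕ → Finset H) (U : Ultrafilter ℕ) (f : H → ℝ) : ℝ :=
  if BddFun f then limUnder (U : Filter ℕ) fun k => avg (F k) f else 0

variable {F : ℕ → Finset H}

theorem tendsto_folnerMean (hF : ∀ k, (F k).Nonempty) (U : Ultrafilter ℕ) {f : H → ℝ}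
    (hf : BddFun f) : Tendsto (fun k => avg (F k) f) U (𝓝 (folnerMean F U f)) := by
  classical
  unfold folnerMean
  rw [if_pos hf]
  obtain ⟨C, hC⟩ := hf
  obtain ⟨a, -, ha⟩ := (isCompact_Icc (a := -C) (b := C)).ultrafilter_le_nhds
    (U.map fun k => avg (F k) f) (by
      rw [le_principal_iff]
      exact Filter.mem_map.2 <| Filter.Eventually.of_forall fun k =>
        ⟨le_avg (hF k) fun x => (abs_le.1 (hC x)).1, avg_le (hF k) fun x => (abs_le.1 (hC x)).2⟩)
  exact tendsto_nhds_limUnder ⟨a, ha⟩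

variable [AddCommGroup H]

/-- The sums over `F` and its translate agree on the common part, and each of the two differences
has `|F| - |(h + F) ∩ F|` points. -/
theorem avg_shift_sub_le (F : Finset H) {f : H → ℝ} {C : ℝ} (hC : ∀ x, |f x| ≤ C) (h : H) :
    |avg F (fun x => f (x + h)) - avg F f| ≤
      2 * C * (1 - (((h +ᵥ (F : Set H)) ∩ (F : Set H)).ncard : ℝ) / F.card) := by
  classical
  rcases F.eq_empty_or_nonempty with rfl | hF
  · have hC0 : 0 ≤ C := (abs_nonneg _).trans (hC 0)
    simp [avg, hC0]
  have hcard : (0 : ℝ) < F.card := by exact_mod_cast hF.card_pos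
  let F' := F.map (addRightEmbedding h)
  have hF' : (h +ᵥ (F : Set H)) ∩ (F : Set H) = ((F' ∩ F : Finset H) : Set H) := by
    ext x
    simp only [Set.mem_inter_iff, Set.mem_vadd_set, Finset.mem_coe, F', Finset.mem_inter,
      Finset.mem_map, addRightEmbedding_apply, vadd_eq_add, add_comm h]
  have hcF' : F'.card = F.card := Finset.card_map _
  have hsum : ∑ x ∈ F, f (x + h) = ∑ x ∈ F', f x := by simp [F']
  have h1 : ∑ x ∈ F', f x = ∑ x ∈ F' ∩ F, f x + ∑ x ∈ F' \ F, f x :=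
    (Finset.sum_inter_add_sum_sdiff F' F f).symm
  have h2 : ∑ x ∈ F, f x = ∑ x ∈ F' ∩ F, f x + ∑ x ∈ F \ F', f x := by
    rw [Finset.inter_comm]
    exact (Finset.sum_inter_add_sum_sdiff F F' f).symm
  have hb : ∀ T : Finset H, |∑ x ∈ T, f x| ≤ T.card * C := fun T =>
    (Finset.abs_sum_le_sum_abs _ _).trans
      ((Finset.sum_le_card_nsmul _ _ C fun x _ => hC x).trans_eq (nsmul_eq_mul _ _))
  have c1 : (((F' \ F).card : ℕ) : ℝ) = F.card - (F' ∩ F).card := by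
    have := Finset.card_sdiff_add_card_inter F' F
    rw [hcF'] at this
    rw [← this]
    push_cast
    ring
  have c2 : (((F \ F').card : ℕ) : ℝ) = F.card - (F' ∩ F).card := by
    have := Finset.card_sdiff_add_card_inter F F'
    rw [Finset.inter_comm] at this
    rw [← this]
    push_cast
    ring
  rw [hF', Set.ncard_coe_finset]
  unfold avg
  rw [← sub_div, hsum, h1, h2, abs_div, abs_of_pos hcard, div_le_iff₀ hcard]
  have e : 2 * C * (1 - ((F' ∩ F).card : ℝ) / F.card) * F.card =
      2 * C * (F.card - (F' ∩ F).card) := by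
    field_simp
  rw [e, add_sub_add_left_eq_sub]
  have t1 := hb (F' \ F)
  have t2 := hb (F \ F')
  rw [c1] at t1
  rw [c2] at t2
  have := abs_sub (∑ x ∈ F' \ F, f x) (∑ x ∈ F \ F', f x)
  linarith

theorem isInvMean_folnerMean (hF : IsFolnerSeq F) {U : Ultrafilter ℕ} (hU : (U : Filter ℕ) ≤ atTop) :
    IsInvMean (folnerMean F U) where
  map_add f g hf hg := by
    refine tendsto_nhds_unique (tendsto_folnerMean hF.1 U (hf.add hg)) ?_
    refine ((tendsto_folnerMean hF.1 U hf).add (tendsto_folnerMean hF.1 U hg)).congr fun k => ?_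
    simp [avg, Finset.sum_add_distrib, add_div]
  map_smul c f hf := by
    refine tendsto_nhds_unique (tendsto_folnerMean hF.1 U (hf.smul c)) ?_
    refine ((tendsto_folnerMean hF.1 U hf).const_mul c).congr fun k => ?_
    simp only [avg, Pi.smul_apply, smul_eq_mul, ← Finset.mul_sum, mul_div_assoc]
  le_of_forall_le f C hf h :=
    le_of_tendsto (tendsto_folnerMean hF.1 U hf) (Eventually.of_forall fun k => avg_le (hF.1 k) h)
  map_shift f h hf := by
    refine tendsto_nhds_unique (tendsto_folnerMean hF.1 U (hf.comp fun x => x + h)) ?_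
    have h1 := tendsto_folnerMean hF.1 U hf
    obtain ⟨C, hC⟩ := hf
    have h0 : Tendsto (fun k => avg (F k) (fun x => f (x + h)) - avg (F k) f) U (𝓝 0) := by
      refine squeeze_zero_norm (fun k => avg_shift_sub_le (F k) hC h) ?_
      have := ((hF.2 h).mono_left hU).const_sub 1 |>.const_mul (2 * C)
      simpa using this
    simpa using h0.add h1
  map_unbdd f hf := if_neg hf

/-- The limit is taken along an ultrafilter containing the infinitely many `k` at which the density
exceeds half of the upper density. -/
theorem exists_folnerMean_pos (hF : IsFolnerSeq F) {E : Set H} (hE : 0 < upperDensity F E) :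
    ∃ Λ : (H → ℝ) → ℝ, IsInvMean Λ ∧ 0 < Λ (ind E) := by
  have hfreq := frequently_lt_of_lt_limsup (isCoboundedUnder_dens F E)
    (show upperDensity F E / 2 < _ from half_lt_self hE)
  have : (atTop ⊓ 𝓟 {k | upperDensity F E / 2 <
      ((E ∩ (F k : Set H)).ncard : ℝ) / (F k).card}).NeBot := frequently_mem_iff_neBot.1 hfreq
  let U := Ultrafilter.of (atTop ⊓ 𝓟 {k | upperDensity F E / 2 <
      ((E ∩ (F k : Set H)).ncard : ℝ) / (F k).card})
  have hU : (U : Filter ℕ) ≤ _ := Ultrafilter.of_le _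
  refine ⟨folnerMean F U, isInvMean_folnerMean hF (hU.trans inf_le_left), ?_⟩
  refine (half_pos hE).trans_le (ge_of_tendsto (tendsto_folnerMean hF.1 U (bddFun_ind E)) ?_)
  filter_upwards [le_principal_iff.1 (hU.trans inf_le_right)] with k hk
  rw [avg_ind]
  exact le_of_lt hk

/-- A set of full mean for every invariant mean has uniform density one. -/
theorem hasUniformDensityOne_of_forall_mean {E : Set H}
    (hE : ∀ Λ : (H → ℝ) → ℝ, ∀ hΛ : IsInvMean Λ, E ∈ hΛ.meanFilter) : HasUniformDensityOne E := by
  intro F hF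
  refine le_antisymm (limsup_le_of_le (isCoboundedUnder_dens F E)
    (Eventually.of_forall fun k => (dens_mem_Icc F E k).2)) ?_
  by_contra! hlt
  obtain ⟨c, hc, hc1⟩ := exists_between hlt
  have hev := eventually_lt_of_limsup_lt hc (isBoundedUnder_dens F E)
  let U := Ultrafilter.of (atTop : Filter ℕ)
  have hU : (U : Filter ℕ) ≤ atTop := Ultrafilter.of_le _
  have hΛ := isInvMean_folnerMean hF hU
  have h0 : folnerMean F U (ind Eᶜ) = 0 := hE _ hΛ
  rw [hΛ.map_ind_compl] at h0
  have := le_of_tendsto (tendsto_folnerMean hF.1 U (bddFun_ind E)) (b := c) (by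
    filter_upwards [hU hev] with k hk
    rw [avg_ind]
    exact le_of_lt hk)
  linarith

/-- Subsequences of Følner sequences are Følner, so a subsequence with densities bounded away from
one would contradict the hypothesis. -/
theorem HasUniformDensityOne.tendsto {E : Set H} (hE : HasUniformDensityOne E)
    (hF : IsFolnerSeq F) : Tendsto (fun k => avg (F k) (ind E)) atTop (𝓝 1) := by
  have hle : ∀ k, avg (F k) (ind E) ≤ 1 := fun k => avg_le (hF.1 k) (ind_le_one E)
  rw [Metric.tendsto_atTop']
  by_contra! hcon
  obtain ⟨ε, hε, hcon⟩ := hcon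
  have hfreq : ∃ᶠ k in atTop, avg (F k) (ind E) ≤ 1 - ε := by
    rw [frequently_atTop']
    intro N
    obtain ⟨n, hn, h⟩ := hcon N
    refine ⟨n, hn, ?_⟩
    rw [Real.dist_eq, abs_sub_comm, abs_of_nonneg (by linarith [hle n])] at h
    linarith
  obtain ⟨φ, hφ, hφle⟩ := extraction_of_frequently_atTop hfreq
  have h1 := hE (fun k => F (φ k))
    ⟨fun k => hF.1 _, fun g => (hF.2 g).comp hφ.tendsto_atTop⟩
  have h2 : upperDensity (fun k => F (φ k)) E ≤ 1 - ε :=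
    limsup_le_of_le (isCoboundedUnder_dens _ E) (Eventually.of_forall fun k => by
      rw [← avg_ind]; exact hφle k)
  linarith

theorem HasUniformDensityOne.mem_meanFilter {E : Set H} (hE : HasUniformDensityOne E)
    (hF : IsFolnerSeq F) {U : Ultrafilter ℕ} (hU : (U : Filter ℕ) ≤ atTop) :
    E ∈ (isInvMean_folnerMean hF hU).meanFilter := by
  rw [IsInvMean.mem_meanFilter, IsInvMean.map_ind_compl (isInvMean_folnerMean hF hU), sub_eq_zero]
  exact tendsto_nhds_unique ((hE.tendsto hF).mono_left hU)
    (tendsto_folnerMean hF.1 U (bddFun_ind E))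

theorem upperDensity_univ (hF : IsFolnerSeq F) : upperDensity F Set.univ = 1 := by
  have : ∀ k, ((Set.univ ∩ (F k : Set H)).ncard : ℝ) / (F k).card = 1 := fun k => by
    rw [Set.univ_inter, Set.ncard_coe_finset]
    exact div_self (by exact_mod_cast (hF.1 k).card_pos.ne')
  simp only [upperDensity, this]
  exact limsup_const 1

end Folner

/-! ### Existence of Følner sequences in countable abelian groups -/

section Existence
variable {H : Type*} [AddCommGroup H]

open Classical in
/-- All sums `∑ i < k, n i • e i` with `0 ≤ n i < N`. -/
noncomputable def boxSums (e : ℕ → H) (k N : ℕ) : Finset H :=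
  (Fintype.piFinset fun _ : Fin k => Finset.range N).image fun n => ∑ i : Fin k, n i • e i

theorem mem_boxSums {e : ℕ → H} {k N : ℕ} {x : H} :
    x ∈ boxSums e k N ↔ ∃ n : Fin k → ℕ, (∀ i, n i < N) ∧ ∑ i, n i • e i = x := by
  simp [boxSums]

theorem boxSums_nonempty (e : ℕ → H) (k N : ℕ) : (boxSums e k (N + 1)).Nonempty :=
  ⟨0, mem_boxSums.2 ⟨fun _ => 0, by simp, by simp⟩⟩

theorem boxSums_mono (e : ℕ → H) (k : ℕ) {N M : ℕ} (h : N ≤ M) : boxSums e k N ⊆ boxSums e k M := by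
  intro x hx
  obtain ⟨n, hn, rfl⟩ := mem_boxSums.1 hx
  exact mem_boxSums.2 ⟨n, fun i => (hn i).trans_le h, rfl⟩

theorem card_boxSums_le (e : ℕ → H) (k N : ℕ) : (boxSums e k N).card ≤ N ^ k := by
  classical
  refine Finset.card_image_le.trans ?_
  simp

theorem add_mem_boxSums {e : ℕ → H} {k N i : ℕ} (hi : i < k) {x : H} (hx : x ∈ boxSums e k N) :
    e i + x ∈ boxSums e k (N + 1) := by
  classical
  obtain ⟨n, hn, rfl⟩ := mem_boxSums.1 hx
  refine mem_boxSums.2 ⟨n + Pi.single ⟨i, hi⟩ 1, fun j => ?_, ?_⟩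
  · have := hn j
    by_cases hj : j = ⟨i, hi⟩
    · subst hj
      simpa using this
    · simp [hj]
      omega
  · simp only [Pi.add_apply, add_smul, Finset.sum_add_distrib]
    rw [add_comm]
    congr 1
    rw [Finset.sum_eq_single ⟨i, hi⟩]
    · simp
    · intro j _ hj
      simp [hj]
    · simp

/-- Polynomial growth forces a scale at which the growth ratio is close to one. -/
theorem exists_card_boxSums_le (e : ℕ → H) (k : ℕ) {ε : ℝ} (hε : 0 < ε) :
    ∃ N, ((boxSums e k (N + 2)).card : ℝ) ≤ (1 + ε) * (boxSums e k (N + 1)).card := by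
  by_contra! hcon
  have hgrow : ∀ N : ℕ, (1 + ε) ^ N ≤ ((boxSums e k (N + 1)).card : ℝ) := by
    intro N
    induction N with
    | zero => simpa using (boxSums_nonempty e k 0)
    | succ N ih =>
      rw [pow_succ, mul_comm]
      exact (mul_le_mul_of_nonneg_left ih (by linarith)).trans (hcon N).le
  have hlim : Tendsto (fun n : ℕ => (n : ℝ) ^ k / (1 + ε) ^ n) atTop (𝓝 0) :=
    tendsto_pow_const_div_const_pow_of_one_lt k (by linarith)
  -- Evaluating the limit at `n + 1` against `(1 + ε)⁻¹` gives `(n + 1) ^ k < (1 + ε) ^ n`, which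
  -- contradicts the bounds on the size of the box.
  obtain ⟨n, hn⟩ := ((hlim.comp (tendsto_add_atTop_nat 1)).eventually
    (gt_mem_nhds (show (0 : ℝ) < (1 + ε)⁻¹ by positivity))).exists
  simp only [Function.comp] at hn
  rw [div_lt_iff₀ (by positivity), pow_succ', inv_mul_cancel_left₀ (by linarith)] at hn
  have h2 : ((boxSums e k (n + 1)).card : ℝ) ≤ ((n + 1 : ℕ) : ℝ) ^ k := by
    exact_mod_cast card_boxSums_le e k (n + 1)
  linarith [hgrow n]

/-- The box and its translate by `e i` both lie in the next box, whose size is at most `1 + ε` times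
larger; inclusion-exclusion bounds their overlap from below. -/
theorem one_sub_le_dens_boxSums (e : ℕ → H) {k i N : ℕ} (hi : i < k) {ε : ℝ}
    (hN : ((boxSums e k (N + 2)).card : ℝ) ≤ (1 + ε) * (boxSums e k (N + 1)).card) :
    1 - ε ≤ (((e i +ᵥ (boxSums e k (N + 1) : Set H)) ∩ (boxSums e k (N + 1) : Set H)).ncard : ℝ) /
      (boxSums e k (N + 1)).card := by
  classical
  have hpos : (0 : ℝ) < (boxSums e k (N + 1)).card := by
    exact_mod_cast (boxSums_nonempty e k N).card_pos
  have hadd : ∀ x ∈ boxSums e k (N + 1), e i + x ∈ boxSums e k (N + 2) :=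
    fun x hx => add_mem_boxSums hi hx
  have hmono : boxSums e k (N + 1) ⊆ boxSums e k (N + 2) := boxSums_mono e k (by omega)
  generalize boxSums e k (N + 1) = F at *
  generalize boxSums e k (N + 2) = F₂ at *
  have hF' : (e i +ᵥ (F : Set H)) ∩ (F : Set H) =
      ((F.map (addLeftEmbedding (e i)) ∩ F : Finset H) : Set H) := by
    ext x
    simp only [Set.mem_inter_iff, Set.mem_vadd_set, Finset.mem_coe, Finset.mem_inter,
      Finset.mem_map, addLeftEmbedding_apply, vadd_eq_add]
  have hsub : F.map (addLeftEmbedding (e i)) ∪ F ⊆ F₂ := by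
    refine Finset.union_subset (fun x hx => ?_) hmono
    obtain ⟨y, hy, rfl⟩ := Finset.mem_map.1 hx
    exact hadd y hy
  have hunion := Finset.card_union_add_card_inter (F.map (addLeftEmbedding (e i))) F
  rw [Finset.card_map] at hunion
  have hunion' : ((F.map (addLeftEmbedding (e i)) ∪ F).card : ℝ) +
      (F.map (addLeftEmbedding (e i)) ∩ F).card = F.card + F.card := by exact_mod_cast hunion
  have hle : ((F.map (addLeftEmbedding (e i)) ∪ F).card : ℝ) ≤ (1 + ε) * F.card :=
    le_trans (by exact_mod_cast Finset.card_le_card hsub) hN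
  rw [hF', Set.ncard_coe_finset, le_div_iff₀ hpos]
  linarith

theorem exists_isFolnerSeq (H : Type*) [AddCommGroup H] [Countable H] :
    ∃ F : ℕ → Finset H, IsFolnerSeq F := by
  obtain ⟨e, he⟩ := exists_surjective_nat H
  choose N hN using fun k : ℕ => exists_card_boxSums_le e k (show (0 : ℝ) < 1 / ((k : ℝ) + 1) by
    positivity)
  refine ⟨fun k => boxSums e k (N k + 1), fun k => boxSums_nonempty e k _, fun g => ?_⟩
  obtain ⟨i, rfl⟩ := he g
  have hlow : Tendsto (fun k : ℕ => 1 - 1 / ((k : ℝ) + 1)) atTop (𝓝 1) := by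
    simpa using tendsto_one_div_add_atTop_nhds_zero_nat.const_sub (1 : ℝ)
  refine tendsto_of_tendsto_of_tendsto_of_le_of_le' hlow tendsto_const_nhds ?_
    (Eventually.of_forall fun k => (dens_mem_Icc (fun k => boxSums e k (N k + 1)) _ k).2)
  filter_upwards [eventually_gt_atTop i] with k hk using one_sub_le_dens_boxSums e hk (hN k)

end Existence
-- Means of multicorrelations for ergodic actions
section Ergodic

variable {G Y : Type*} [AddCommGroup G] [MeasurableSpace Y] [AddAction G Y]
  [MeasurableConstVAdd G Y] {ν : Measure Y}

/-- A finite invariant measure that is absolutely continuous with respect to an ergodic finite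
measure is a multiple of it. -/
theorem exists_eq_smul_of_ergodicVAdd [IsFiniteMeasure ν] [ErgodicVAdd G Y ν] {ρ : Measure Y}
    [IsFiniteMeasure ρ] (hρ : ∀ g : G, MeasurePreserving (g +ᵥ · : Y → Y) ρ ρ) (hac : ρ ≪ ν) :
    ∃ c : ENNReal, ρ = c • ν := by
  have hinv : ∀ g : G, ρ.rnDeriv ν ∘ (g +ᵥ · : Y → Y) =ᵐ[ν] ρ.rnDeriv ν := fun g =>
    (hρ g).rnDeriv_comp_aeEq (measurePreserving_vadd g ν)
  obtain ⟨c, hc⟩ : ∃ c, ρ.rnDeriv ν =ᵐ[ν] Function.const Y c := by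
    -- The density is invariant, so by ergodicity its preimages of measurable sets are null or
    -- conull, and it is constant.
    refine exists_eventuallyEq_const_of_forall_separating MeasurableSet fun U hU => ?_
    refine eventuallyConst_set.1 (aeconst_of_forall_preimage_vadd_ae_eq G
      (s := ρ.rnDeriv ν ⁻¹' U) (Measure.measurable_rnDeriv ρ ν hU).nullMeasurableSet fun g => ?_)
    refine ((hinv g).mono fun x hx => ?_).set_eq
    change ρ.rnDeriv ν (g +ᵥ x) ∈ U ↔ ρ.rnDeriv ν x ∈ U
    rw [← hx]
    rfl
  refine ⟨c, ?_⟩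
  ext s hs
  calc
    ρ s = ∫⁻ a in s, ρ.rnDeriv ν a ∂ν := .symm <| Measure.setLIntegral_rnDeriv hac _
    _ = ∫⁻ _ in s, c ∂ν := lintegral_congr_ae <| hc.filter_mono <| ae_mono Measure.restrict_le_self
    _ = (c • ν) s := by simp

/-- A finitely additive set function dominated by a finite measure is countably additive. -/
theorem hasSum_of_additive_of_le [IsFiniteMeasure ν] {ρ : Set Y → ℝ}
    (hnn : ∀ A, 0 ≤ ρ A) (hle : ∀ A, MeasurableSet A → ρ A ≤ ν.real A)
    (hadd : ∀ A B, MeasurableSet A → MeasurableSet B → Disjoint A B → ρ (A ∪ B) = ρ A + ρ B)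
    {f : ℕ → Set Y} (hf : ∀ i, MeasurableSet (f i)) (hd : Pairwise (Function.onFun Disjoint f)) :
    HasSum (fun i => ρ (f i)) (ρ (⋃ i, f i)) := by
  rw [hasSum_iff_tendsto_nat_of_nonneg fun i => hnn _]
  have h0 : ρ ∅ = 0 := le_antisymm (by simpa using hle ∅ .empty) (hnn _)
  let P : ℕ → Set Y := fun n => ⋃ i ∈ Finset.range n, f i
  have hPm : ∀ n, MeasurableSet (P n) := fun n => Finset.measurableSet_biUnion _ fun i _ => hf i
  have hUm : MeasurableSet (⋃ i, f i) := .iUnion hf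
  have hPsub : ∀ n, P n ⊆ ⋃ i, f i := fun n => Set.iUnion₂_subset fun i _ => Set.subset_iUnion f i
  have hPsum : ∀ n, ∑ i ∈ Finset.range n, ρ (f i) = ρ (P n) := by
    intro n
    induction n with
    | zero => simp [P, h0]
    | succ n ih =>
      have : P (n + 1) = P n ∪ f n := by
        simp only [P, Finset.range_add_one, Finset.set_biUnion_insert, Set.union_comm]
      rw [Finset.sum_range_succ, ih, this, hadd _ _ (hPm n) (hf n)]
      refine Set.disjoint_iUnion₂_left.2 fun i hi => hd ?_
      exact (Finset.mem_range.1 hi).ne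
  simp only [hPsum]
  -- Domination by `ν` makes the `ρ`-mass of the tails vanish, which upgrades finite to countable
  -- additivity.
  have hlim : Tendsto (fun n => ν.real ((⋃ i, f i) \ P n)) atTop (𝓝 0) := by
    have hmono : Monotone P := fun a b hab => Set.biUnion_subset_biUnion_left fun i hi =>
      Finset.range_mono hab hi
    have hPU : ⋃ n, P n = ⋃ i, f i := by
      refine Set.Subset.antisymm (Set.iUnion_subset hPsub) (Set.iUnion_subset fun i => ?_)
      refine Set.Subset.trans ?_ (Set.subset_iUnion P (i + 1))
      exact Set.subset_biUnion_of_mem (u := f) (by simp : i ∈ (Finset.range (i + 1)))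
    have h1 := tendsto_measure_iUnion_atTop (μ := ν) hmono
    rw [hPU] at h1
    have h2 := ((ENNReal.tendsto_toReal (measure_ne_top ν _)).comp h1).const_sub
      (ν.real (⋃ i, f i))
    rw [show ν.real (⋃ i, f i) - (ν (⋃ i, f i)).toReal = 0 from sub_self _] at h2
    refine h2.congr fun n => ?_
    rw [measureReal_sdiff (hPsub n) (hPm n)]
    rfl
  have hsub : ∀ n, ρ (P n) = ρ (⋃ i, f i) - ρ ((⋃ i, f i) \ P n) := fun n => by
    have := hadd _ _ (hPm n) (hUm.diff (hPm n)) Set.disjoint_sdiff_right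
    rw [Set.union_sdiff_cancel (hPsub n)] at this
    linarith
  simp only [hsub]
  simpa using (squeeze_zero (fun n => hnn _) (fun n => hle _ (hUm.diff (hPm n))) hlim).const_sub
    (ρ (⋃ i, f i))

/-- An invariant finitely additive set function dominated by an ergodic probability measure is a
multiple of it. -/
theorem eq_mul_of_ergodicVAdd [IsProbabilityMeasure ν] [ErgodicVAdd G Y ν] {ρ : Set Y → ℝ}
    (hnn : ∀ A, 0 ≤ ρ A) (hle : ∀ A, MeasurableSet A → ρ A ≤ ν.real A)
    (hadd : ∀ A B, MeasurableSet A → MeasurableSet B → Disjoint A B → ρ (A ∪ B) = ρ A + ρ B)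
    (hinv : ∀ (g : G) A, ρ (g +ᵥ A) = ρ A) {A : Set Y} (hA : MeasurableSet A) :
    ρ A = ρ Set.univ * ν.real A := by
  have h0 : ρ ∅ = 0 := le_antisymm (by simpa using hle ∅ .empty) (hnn _)
  let m : Measure Y := Measure.ofMeasurable (fun A _ => ENNReal.ofReal (ρ A)) (by simp [h0])
    fun f hf hd => by
      have hs := hasSum_of_additive_of_le hnn hle hadd hf hd
      rw [← hs.tsum_eq, ENNReal.ofReal_tsum_of_nonneg (fun i => hnn _) hs.summable]
  have hm : ∀ A, MeasurableSet A → m A = ENNReal.ofReal (ρ A) := fun A hA =>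
    Measure.ofMeasurable_apply A hA
  have hmle : ∀ A, MeasurableSet A → m A ≤ ν A := fun A hA => by
    rw [hm A hA, ← ofReal_measureReal]
    exact ENNReal.ofReal_le_ofReal (hle A hA)
  have : IsFiniteMeasure m := ⟨(hmle _ .univ).trans_lt (measure_lt_top _ _)⟩
  have hac : m ≪ ν := Measure.AbsolutelyContinuous.mk fun s hs h =>
    le_antisymm (h ▸ hmle s hs) (zero_le)
  obtain ⟨c, hc⟩ := exists_eq_smul_of_ergodicVAdd (G := G) (ν := ν) (ρ := m)
    (fun g => ⟨measurable_const_vadd g, by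
      ext s hs
      rw [Measure.map_apply (measurable_const_vadd g) hs, hm _ (measurable_const_vadd g hs), hm s hs,
        Set.preimage_vadd, hinv]⟩) hac
  have hreal : ∀ A, MeasurableSet A → ρ A = c.toReal * ν.real A := fun A hA => by
    rw [← ENNReal.toReal_ofReal (hnn A), ← hm A hA, hc]
    simp [measureReal_def]
  rw [hreal A hA, hreal _ .univ]
  simp

/-- Replacing `A` by `h +ᵥ A` is a shift of coordinate `j`, which leaves `C` unchanged. So the left
side is an invariant, finitely additive function of `A` dominated by `ν`, and `A = univ` supplies
the constant. -/
theorem map_measureReal_inter_vadd [IsProbabilityMeasure ν] [ErgodicVAdd G Y ν] {n : ℕ}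
    {Λ : ((Fin n → G) → ℝ) → ℝ} (hΛ : IsInvMean Λ) (j : Fin n) {C : (Fin n → G) → Set Y}
    (hCm : ∀ g, MeasurableSet (C g)) (hC : ∀ g h, C (g + Pi.single j h) = C g) {A : Set Y}
    (hA : MeasurableSet A) :
    Λ (fun g => ν.real (C g ∩ (g j +ᵥ A))) = Λ (fun g => ν.real (C g)) * ν.real A := by
  have hb : ∀ A : Set Y, BddFun fun g => ν.real (C g ∩ (g j +ᵥ A)) := fun A =>
    .of_mem_Icc (fun g => measureReal_nonneg) fun g => measureReal_le_one
  have := eq_mul_of_ergodicVAdd (G := G) (ν := ν)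
    (ρ := fun A => Λ (fun g => ν.real (C g ∩ (g j +ᵥ A))))
    (fun A => hΛ.nonneg fun g => measureReal_nonneg) (fun A _ => ?_) (fun A B hA hB hd => ?_)
    (fun h A => ?_) hA
  · simpa using this
  · refine hΛ.le_of_forall_le _ _ (hb A) fun g => ?_
    have : ν.real (g j +ᵥ A) = ν.real A := by simp [measureReal_def, measure_vadd]
    exact this ▸ measureReal_mono Set.inter_subset_right
  · rw [← hΛ.map_add _ _ (hb A) (hb B)]
    congr 1
    funext g
    rw [Pi.add_apply, Set.vadd_set_union, Set.inter_union_distrib_left, measureReal_union]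
    · exact ((Set.disjoint_vadd_set.2 hd).mono Set.inter_subset_right Set.inter_subset_right)
    · exact (hCm g).inter (hB.const_vadd _)
  · rw [← hΛ.map_shift _ (Pi.single j h) (hb A)]
    congr 1
    funext g
    simp [hC, add_vadd]

theorem measurableSet_vadd_iInter {n : ℕ} {A : Fin (n + 1) → Set Y}
    (hA : ∀ j, MeasurableSet (A j)) (s : Finset (Fin n)) (g : Fin n → G) :
    MeasurableSet (A 0 ∩ ⋂ j ∈ s, (g j +ᵥ A j.succ)) :=
  (hA 0).inter (Finset.measurableSet_biInter _ fun j _ => (hA j.succ).const_vadd _)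

/-- For an ergodic action, any invariant mean of the multicorrelation is the product of the
measures. -/
theorem map_multiCorrelation [IsProbabilityMeasure ν] [ErgodicVAdd G Y ν] {n : ℕ}
    {Λ : ((Fin n → G) → ℝ) → ℝ} (hΛ : IsInvMean Λ) {A : Fin (n + 1) → Set Y}
    (hA : ∀ j, MeasurableSet (A j)) : Λ (multiCorrelation ν A) = ∏ j, ν.real (A j) := by
  classical
  -- The factors are split off one by one: those indexed by `s` do not depend on a coordinate
  -- outside `s`.
  have key : ∀ s : Finset (Fin n), Λ (fun g => ν.real (A 0 ∩ ⋂ j ∈ s, (g j +ᵥ A j.succ))) =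
      ν.real (A 0) * ∏ j ∈ s, ν.real (A j.succ) := by
    intro s
    induction s using Finset.induction_on with
    | empty => simpa using hΛ.map_const _
    | insert a s ha ih =>
      rw [Finset.prod_insert ha, mul_left_comm, ← ih, mul_comm,
        ← map_measureReal_inter_vadd hΛ a (measurableSet_vadd_iInter hA s) _ (hA a.succ)]
      · congr 1
        funext g
        rw [Finset.set_biInter_insert, Set.inter_left_comm, Set.inter_comm]
      · intro g h
        congr 1
        refine Set.iInter₂_congr fun j (hj : j ∈ s) => ?_
        have : j ≠ a := fun h => ha (h ▸ hj)
        simp [this]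
  have := key Finset.univ
  simp only [Finset.mem_univ, Set.iInter_true] at this
  rw [Fin.prod_univ_succ, ← this]
  rfl

end Ergodic

/-! ### Weak mixing and the second moment -/

section WeakMixing

theorem bddFun_multiCorrelation {G X : Type*} [AddCommGroup G] [MeasurableSpace X]
    [AddAction G X] {μ : Measure X} [IsProbabilityMeasure μ]
    {n : ℕ} (A : Fin (n + 1) → Set X) :
    BddFun (multiCorrelation μ A : (Fin n → G) → ℝ) :=
  .of_mem_Icc (fun _ => measureReal_nonneg) fun _ => measureReal_le_one

theorem vadd_prod_set {G X : Type*} [AddCommGroup G] [AddAction G X] (g : G) (A B : Set X) : g +ᵥ (A ×ˢ B) = (g +ᵥ A) ×ˢ (g +ᵥ B) := by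
  ext x
  simp only [Set.mem_vadd_set_iff_neg_vadd_mem, Set.mem_prod]
  rfl

variable {G X : Type*} [AddCommGroup G] [MeasurableSpace X] [AddAction G X]
  {μ : Measure X} [IsProbabilityMeasure μ]

/-- This turns second moments on `X` into first moments on `X × X`. -/
theorem multiCorrelation_prod {n : ℕ} (A : Fin (n + 1) → Set X) (g : Fin n → G) :
    multiCorrelation (μ.prod μ) (fun j => A j ×ˢ A j) g = multiCorrelation μ A g ^ 2 := by
  have : (A 0 ×ˢ A 0) ∩ ⋂ j : Fin n, (g j +ᵥ (A j.succ ×ˢ A j.succ)) =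
      (A 0 ∩ ⋂ j : Fin n, (g j +ᵥ A j.succ)) ×ˢ (A 0 ∩ ⋂ j : Fin n, (g j +ᵥ A j.succ)) := by
    ext x
    simp only [vadd_prod_set, Set.mem_inter_iff, Set.mem_prod, Set.mem_iInter]
    exact ⟨fun ⟨⟨a, b⟩, c⟩ => ⟨⟨a, fun i => (c i).1⟩, b, fun i => (c i).2⟩,
      fun ⟨⟨a, c⟩, b, d⟩ => ⟨⟨a, b⟩, fun i => ⟨c i, d i⟩⟩⟩
  unfold multiCorrelation
  rw [this, measureReal_prod_prod, pow_two]

/-- The action on `X` is a factor of the diagonal action through the first projection. -/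
theorem IsWeaklyMixing.ergodicVAdd [VAddInvariantMeasure G X μ] (h : IsWeaklyMixing G μ) :
    ErgodicVAdd G X μ where
  aeconst_of_forall_preimage_vadd_ae_eq {s} hs hinv := by
    have h : ErgodicVAdd G (X × X) (μ.prod μ) := h
    have hfst : MeasurePreserving (Prod.fst : X × X → X) (μ.prod μ) μ := measurePreserving_fst
    have := h.aeconst_of_forall_preimage_vadd_ae_eq (s := Prod.fst ⁻¹' s) (measurable_fst hs)
      fun g => hfst.quasiMeasurePreserving.preimage_ae_eq (hinv g)
    have key : ∀ t : Set X, MeasurableSet t → (∀ᵐ x ∂μ.prod μ, x.1 ∈ t) → ∀ᵐ x ∂μ, x ∈ t :=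
      fun t ht h => by
        rw [← hfst.map_eq]
        exact (ae_map_iff hfst.measurable.aemeasurable ht).2 h
    exact eventuallyConst_set.2 ((eventuallyConst_set.1 this).imp (key s hs) (key sᶜ hs.compl))

variable [MeasurableConstVAdd G X]

instance measurableConstVAdd_prod : MeasurableConstVAdd G (X × X) where
  measurable_const_vadd g := ((measurable_const_vadd g).comp measurable_fst).prodMk
    ((measurable_const_vadd g).comp measurable_snd)

/-- For a weakly mixing action, the multicorrelations tend to the product of the measures along
the sets of full mean, for every invariant mean. -/
theorem IsWeaklyMixing.tendsto_multiCorrelation [VAddInvariantMeasure G X μ]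
    (h : IsWeaklyMixing G μ) {n : ℕ}
    {Λ : ((Fin n → G) → ℝ) → ℝ} (hΛ : IsInvMean Λ) {A : Fin (n + 1) → Set X}
    (hA : ∀ j, MeasurableSet (A j)) :
    Tendsto (multiCorrelation μ A) hΛ.meanFilter (𝓝 (∏ j, μ.real (A j))) := by
  have hX : ErgodicVAdd G X μ := h.ergodicVAdd
  have hXX : ErgodicVAdd G (X × X) (μ.prod μ) := h
  set p := ∏ j, μ.real (A j) with hp
  have hb := bddFun_multiCorrelation (G := G) (μ := μ) A
  refine hΛ.tendsto_of_sq hb ?_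
  have h1 : Λ (multiCorrelation μ A) = p := map_multiCorrelation hΛ hA
  -- Ergodicity of the product computes the second moment; with `h1` the variance is `p ^ 2 - 2 * p
  -- * p + p ^ 2 = 0`.
  have h2 : Λ (multiCorrelation μ A * multiCorrelation μ A) = p ^ 2 := by
    have := map_multiCorrelation (ν := μ.prod μ) hΛ fun j => (hA j).prod (hA j)
    simp only [measureReal_prod_prod, Finset.prod_mul_distrib] at this
    rw [pow_two, hp, ← this]
    congr 1
    funext g
    rw [multiCorrelation_prod, pow_two, Pi.mul_apply]
  have : (fun g => (multiCorrelation μ A g - p) ^ 2) =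
      multiCorrelation μ A * multiCorrelation μ A - (2 * p) • multiCorrelation μ A +
        fun _ : Fin n → G => p ^ 2 := by
    funext g
    simp only [Pi.add_apply, Pi.sub_apply, Pi.mul_apply, Pi.smul_apply, smul_eq_mul]
    ring
  rw [this, hΛ.map_add _ _ ((hb.mul hb).sub (hb.smul _)) (.const _),
    hΛ.map_sub (hb.mul hb) (hb.smul _), hΛ.map_smul _ _ hb, hΛ.map_const, h1, h2]
  ring

end WeakMixing
-- Sums inside a set of positive mean
section Sequences

variable {H : Type*} [AddCommGroup H] {Λ : (H → ℝ) → ℝ}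

theorem IsInvMean.exists_mem_of_pos (hΛ : IsInvMean Λ) {D S : Set H} (hS : 0 < Λ (ind S))
    (hD : D ∈ hΛ.meanFilter) : ∃ x ∈ D, x ∈ S := by
  by_contra! h
  exact hS.ne' (hΛ.ind_eq_zero_mono (fun x hx hxD => h x hxD hx) hD)

/-- Induction on `m`: the set obtained for the bound `N = k` serves as the `k`-th target of the new
last coordinate. If the last index is `k`, all earlier indices are below `k`, which is what that
target controls. Positivity of the mean is what keeps the induction going. -/
theorem IsExtremeMean.exists_seq_sum_pos (hext : IsExtremeMean Λ) {E : Set H}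
    (hE : 0 < Λ (ind E)) {D : ℕ → Set H} (hD : ∀ k, D k ∈ hext.isInvMean.meanFilter) (m : ℕ) :
    ∃ h : ℕ → Fin m → H, (∀ k t, h k t ∈ D k) ∧
      ∀ N, 0 < Λ (ind {x | ∀ κ : Fin m → ℕ, StrictMono κ → (∀ t, κ t < N) →
        x + ∑ t, h (κ t) t ∈ E}) := by
  have hΛ := hext.isInvMean
  induction m with
  | zero =>
    refine ⟨fun _ t => t.elim0, fun _ t => t.elim0, fun N => hE.trans_le ?_⟩
    exact hΛ.mono (bddFun_ind _) (bddFun_ind _) (ind_mono fun x hx κ _ _ => by simpa using hx)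
  | succ m ih =>
    obtain ⟨h, hhD, hpos⟩ := ih
    obtain ⟨h', hhD', hpos'⟩ := hext.exists_seq_inter_pos hpos hD
    refine ⟨fun k => Fin.snoc (h k) (h' k), fun k t => ?_, fun N => (hpos' N).trans_le ?_⟩
    · induction t using Fin.lastCases with
      | last => simpa using hhD' k
      | cast t => simpa using hhD k t
    · refine hΛ.mono (bddFun_ind _) (bddFun_ind _) (ind_mono fun x hx κ hκ hκN => ?_)
      have := hx (κ (Fin.last m)) (hκN _) (fun t => κ t.castSucc)
        (hκ.comp (Fin.strictMono_castSucc)) fun t => hκ (Fin.castSucc_lt_last t)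
      rw [Fin.sum_univ_castSucc, add_comm (∑ _, _), ← add_assoc]
      simpa using this

/-- A set of positive mean contains all increasing sums along suitable sequences, whose terms can be
chosen in prescribed sets of full mean. -/
theorem IsExtremeMean.exists_seq_sum_mem (hext : IsExtremeMean Λ) {E : Set H}
    (hE : 0 < Λ (ind E)) {D : ℕ → Set H} (hD : ∀ k, D k ∈ hext.isInvMean.meanFilter) {m : ℕ}
    (hm : 0 < m) :
    ∃ h : ℕ → Fin m → H, (∀ k t, h k t ∈ D k) ∧
      ∀ κ : Fin m → ℕ, StrictMono κ → ∑ t, h (κ t) t ∈ E := by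
  obtain ⟨m, rfl⟩ := Nat.exists_eq_succ_of_ne_zero hm.ne'
  obtain ⟨h, hhD, hpos⟩ := hext.exists_seq_sum_pos hE hD m
  -- The base point itself becomes the last of the `m` summands, so that no translate remains.
  choose h' hhD' hh' using fun k => hext.isInvMean.exists_mem_of_pos (hpos k) (hD k)
  refine ⟨fun k => Fin.snoc (h k) (h' k), fun k t => ?_, fun κ hκ => ?_⟩
  · induction t using Fin.lastCases with
    | last => simpa using hhD' k
    | cast t => simpa using hhD k t
  · have := hh' (κ (Fin.last m)) (fun t => κ t.castSucc)
      (hκ.comp (Fin.strictMono_castSucc)) fun t => hκ (Fin.castSucc_lt_last t)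
    rw [Fin.sum_univ_castSucc, add_comm (∑ _, _)]
    simpa using this

end Sequences

/-! ### Reduction to a countable dense family -/

section Approximation

variable {G X : Type*} [AddCommGroup G] [MeasurableSpace X] [AddAction G X] {μ : Measure X}

/-- The coarsest filter along which the multicorrelations of sets of a given family converge to the
products of their measures. -/
def mixFilter (G : Type*) [AddCommGroup G] [AddAction G X] (μ : Measure X) (𝒜 : Set (Set X))
    (n : ℕ) : Filter (Fin n → G) :=
  ⨅ A : Fin (n + 1) → 𝒜, comap (multiCorrelation μ fun j => (A j : Set X))
    (𝓝 (∏ j, μ.real (A j : Set X)))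

theorem isCountablyGenerated_mixFilter {𝒜 : Set (Set X)} (h𝒜 : 𝒜.Countable) (n : ℕ) :
    (mixFilter G μ 𝒜 n).IsCountablyGenerated := by
  have := h𝒜.to_subtype
  unfold mixFilter
  infer_instance

variable [MeasurableConstVAdd G X] [IsProbabilityMeasure μ] [VAddInvariantMeasure G X μ]

theorem abs_multiCorrelation_sub_le {n : ℕ} {A B : Fin (n + 1) → Set X}
    (hA : ∀ j, MeasurableSet (A j)) (hB : ∀ j, MeasurableSet (B j)) (g : Fin n → G) :
    |multiCorrelation μ A g - multiCorrelation μ B g| ≤ ∑ j, μ.real (symmDiff (A j) (B j)) := by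
  have hm : ∀ A : Fin (n + 1) → Set X, (∀ j, MeasurableSet (A j)) →
      MeasurableSet (A 0 ∩ ⋂ j : Fin n, (g j +ᵥ A j.succ)) := fun A hA =>
    (hA 0).inter (MeasurableSet.iInter fun j => (hA j.succ).const_vadd _)
  refine (abs_measureReal_sub_le_measureReal_symmDiff (hm A hA).nullMeasurableSet
    (hm B hB).nullMeasurableSet).trans ?_
  have hsub : symmDiff (A 0 ∩ ⋂ j : Fin n, (g j +ᵥ A j.succ)) (B 0 ∩ ⋂ j : Fin n, (g j +ᵥ B j.succ))
      ⊆ symmDiff (A 0) (B 0) ∪ ⋃ j : Fin n, (g j +ᵥ symmDiff (A j.succ) (B j.succ)) := by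
    intro x hx
    by_contra hcon
    simp only [Set.mem_union, Set.mem_iUnion, not_or, not_exists, Set.mem_symmDiff,
      Set.mem_vadd_set_iff_neg_vadd_mem] at hcon
    simp only [Set.mem_symmDiff, Set.mem_inter_iff, Set.mem_iInter,
      Set.mem_vadd_set_iff_neg_vadd_mem] at hx
    have h0 : x ∈ A 0 ↔ x ∈ B 0 := by tauto
    have h1 : ∀ j : Fin n, -g j +ᵥ x ∈ A j.succ ↔ -g j +ᵥ x ∈ B j.succ := fun j => by
      have := hcon.2 j
      tauto
    simp only [h0, h1] at hx
    tauto
  refine (measureReal_mono hsub).trans ((measureReal_union_le _ _).trans ?_)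
  rw [Fin.sum_univ_succ]
  gcongr
  refine (measureReal_iUnion_fintype_le _).trans_eq ?_
  simp [measureReal_def, measure_vadd]

/-- Convergence of multicorrelations on a measure-dense family implies convergence for all
measurable sets. -/
theorem tendsto_multiCorrelation_of_measureDense {𝒜 : Set (Set X)} (h𝒜 : μ.MeasureDense 𝒜) {n : ℕ}
    {ι : Type*} {l : Filter ι} {γ : ι → Fin n → G} (hγ : Tendsto γ l (mixFilter G μ 𝒜 n))
    {A : Fin (n + 1) → Set X} (hA : ∀ j, MeasurableSet (A j)) :
    Tendsto (fun i => multiCorrelation μ A (γ i)) l (𝓝 (∏ j, μ.real (A j))) := by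
  have happ : ∀ (N : ℕ) j, ∃ B ∈ 𝒜, μ.real (symmDiff (A j) B) ≤ 1 / ((N : ℝ) + 1) := fun N j => by
    obtain ⟨B, hB, hlt⟩ := h𝒜.approx (A j) (hA j) (measure_ne_top μ _) (1 / ((N : ℝ) + 1))
      (by positivity)
    exact ⟨B, hB, ENNReal.toReal_le_of_le_ofReal (by positivity) hlt.le⟩
  choose B hB𝒜 hB using happ
  have hBm : ∀ N j, MeasurableSet (B N j) := fun N j => h𝒜.measurable _ (hB𝒜 N j)
  have hzero := tendsto_one_div_add_atTop_nhds_zero_nat (𝕜 := ℝ)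
  -- Interchange of limits: the error of replacing `A` by `B N` is at most `(n + 1) / (N + 1)`,
  -- uniformly in the group elements.
  refine TendstoUniformlyOnFilter.tendsto_of_eventually_tendsto (p := atTop)
    (F := fun N i => multiCorrelation μ (B N) (γ i)) (L := fun N => ∏ j, μ.real (B N j)) ?_ ?_ ?_
  · rw [Metric.tendstoUniformlyOnFilter_iff]
    intro ε hε
    have h2 : Tendsto (fun N : ℕ => ((n : ℝ) + 1) * (1 / ((N : ℝ) + 1))) atTop (𝓝 0) := by
      simpa using hzero.const_mul ((n : ℝ) + 1)
    refine ((h2.eventually (gt_mem_nhds hε)).prod_inl l).mono fun x hx => ?_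
    rw [Real.dist_eq]
    refine (abs_multiCorrelation_sub_le hA (hBm x.1) (γ x.2)).trans_lt (lt_of_le_of_lt ?_ hx)
    refine (Finset.sum_le_card_nsmul _ _ _ fun j _ => hB x.1 j).trans_eq ?_
    simp
  · refine Eventually.of_forall fun N => ?_
    have := tendsto_iInf.1 hγ fun j => ⟨B N j, hB𝒜 N j⟩
    exact (tendsto_comap_iff (g := multiCorrelation μ (B N))).1 this
  · refine tendsto_finsetProd _ fun j _ => ?_
    rw [tendsto_iff_dist_tendsto_zero]
    refine squeeze_zero (fun _ => dist_nonneg) (fun N => ?_) hzero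
    rw [dist_comm, Real.dist_eq]
    exact (abs_measureReal_sub_le_measureReal_symmDiff (hA j).nullMeasurableSet
      (hBm N j).nullMeasurableSet).trans (hB N j)

theorem IsWeaklyMixing.meanFilter_le_mixFilter (h : IsWeaklyMixing G μ) {n : ℕ}
    {Λ : ((Fin n → G) → ℝ) → ℝ} (hΛ : IsInvMean Λ) {𝒜 : Set (Set X)}
    (h𝒜 : ∀ s ∈ 𝒜, MeasurableSet s) : hΛ.meanFilter ≤ mixFilter G μ 𝒜 n :=
  le_iInf fun A => tendsto_iff_comap.1 (h.tendsto_multiCorrelation hΛ fun j => h𝒜 _ (A j).2)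

theorem mixingProperty_of_tendsto {𝒜 : Set (Set X)} (h𝒜 : μ.MeasureDense 𝒜) {γ : ℕ → G}
    (hγ : Tendsto (fun k (_ : Fin 1) => γ k) atTop (mixFilter G μ 𝒜 1)) :
    MixingProperty μ fun k (x : X) => γ k +ᵥ x := by
  intro A₀ A₁ h₀ h₁
  -- The sets are swapped because translation by `γ k` turns `A₀ ∩ (γ k)⁻¹ A₁` into `A₁ ∩ γ k A₀`.
  have := tendsto_multiCorrelation_of_measureDense h𝒜 hγ (A := ![A₁, A₀])
    (Fin.forall_fin_two.2 ⟨h₁, h₀⟩)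
  have hprod : ∏ j : Fin (1 + 1), μ.real (![A₁, A₀] j) = μ.real A₀ * μ.real A₁ := by
    rw [Fin.prod_univ_two, mul_comm]
    rfl
  rw [hprod] at this
  refine this.congr fun k => ?_
  have hset : A₁ ∩ ⋂ j : Fin 1, (γ k +ᵥ (![A₁, A₀] j.succ : Set X)) =
      γ k +ᵥ (A₀ ∩ (γ k +ᵥ · : X → X) ⁻¹' A₁) := by
    rw [Set.vadd_set_inter, Set.preimage_vadd, vadd_neg_vadd, Set.inter_comm]
    simp only [Matrix.cons_val_succ, Matrix.cons_val_fin_one]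
    rw [Set.iInter_const]
  unfold multiCorrelation
  rw [measureReal_def, measureReal_def, ← measure_vadd μ (γ k) (A₀ ∩ _), ← hset]
  rfl

end Approximation

/-! ### Consequences of weak mixing -/

section Forward

variable {G X : Type*} [AddCommGroup G] [MeasurableSpace X] [AddAction G X] {μ : Measure X}

theorem isCountablyGenerated_cofinite (G : Type*) [Countable G] :
    (cofinite : Filter G).IsCountablyGenerated :=
  HasCountableBasis.isCountablyGenerated ⟨hasBasis_cofinite, Set.Countable.ofPred_finite⟩

/-- The filter of sets of group elements that are far away and mix well the sets of a family. -/
def mixInftyFilter (G : Type*) [AddCommGroup G] [AddAction G X] (μ : Measure X)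
    (𝒜 : Set (Set X)) : Filter G :=
  cofinite ⊓ comap (fun g (_ : Fin 1) => g) (mixFilter G μ 𝒜 1)

theorem isCountablyGenerated_mixInftyFilter [Countable G] {𝒜 : Set (Set X)} (h𝒜 : 𝒜.Countable) :
    (mixInftyFilter G μ 𝒜).IsCountablyGenerated := by
  have := isCountablyGenerated_mixFilter (G := G) (μ := μ) h𝒜 1
  have := isCountablyGenerated_cofinite G
  unfold mixInftyFilter
  infer_instance

variable [MeasurableConstVAdd G X] [IsProbabilityMeasure μ] [VAddInvariantMeasure G X μ]

/-- A surjective homomorphism pushes `Λ` to an invariant mean on `G`, for which points are null and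
correlations of pairs converge. It is meant for the coordinates of `G ^ ℓ` and their differences. -/
theorem IsWeaklyMixing.tendsto_mixInftyFilter [Infinite G] (h : IsWeaklyMixing G μ)
    {H : Type*} [AddCommGroup H] {Λ : (H → ℝ) → ℝ} (hΛ : IsInvMean Λ) {𝒜 : Set (Set X)}
    (h𝒜 : ∀ s ∈ 𝒜, MeasurableSet s) (φ : H →+ G) (hφ : Function.Surjective φ) :
    Tendsto φ hΛ.meanFilter (mixInftyFilter G μ 𝒜) := by
  refine tendsto_inf.2 ⟨(hΛ.tendsto_comp φ hφ).mono_right (hΛ.comp φ hφ).meanFilter_le_cofinite,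
    tendsto_comap_iff.2 ?_⟩
  let ψ : H →+ (Fin 1 → G) := AddMonoidHom.mk' (fun x _ => φ x) fun x y => by
    funext
    simp
  have hψ : Function.Surjective ψ := fun y => by
    obtain ⟨x, hx⟩ := hφ (y 0)
    exact ⟨x, funext fun i => by rw [Subsingleton.elim i 0, ← hx]; rfl⟩
  exact (hΛ.tendsto_comp ψ hψ).mono_right (h.meanFilter_le_mixFilter (hΛ.comp ψ hψ) h𝒜)

theorem surjective_eval_sub {G : Type*} [AddCommGroup G] {ℓ : ℕ} {i j : Fin ℓ} (hij : i ≠ j) :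
    Function.Surjective (Pi.evalAddMonoidHom (fun _ : Fin ℓ => G) j -
      Pi.evalAddMonoidHom (fun _ : Fin ℓ => G) i) := fun y => by
  classical
  exact ⟨Pi.single j y, by simp [hij]⟩

theorem IsWeaklyMixing.hasUniformDensityOne_mixingSet (h : IsWeaklyMixing G μ) {ℓ : ℕ}
    {A : Fin (ℓ + 1) → Set X} (hA : ∀ j, MeasurableSet (A j)) {ε : ℝ} (hε : 0 < ε) :
    HasUniformDensityOne (mixingSet G μ A ε) :=
  hasUniformDensityOne_of_forall_mean fun _ hΛ =>
    (Metric.tendsto_nhds.1 (h.tendsto_multiCorrelation hΛ hA) ε hε)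

variable {ℓ : ℕ} {F : ℕ → Finset (Fin ℓ → G)} {E : Set (Fin ℓ → G)}

/-- Here `m = 1` suffices: a set of positive mean meets every set of full mean, so points of `E` can
be chosen along a base of the mixing filter. -/
theorem IsWeaklyMixing.exists_hasRLim [IsSeparable μ] (h : IsWeaklyMixing G μ)
    (hF : IsFolnerSeq F) (hE : 0 < upperDensity F E) :
    ∃ m : ℕ, 0 < m ∧ ∃ g : Fin ℓ → ℕ → Fin m → G,
      (∀ α : Set.powersetCard ℕ m, (fun j => sumAlong (g j) α) ∈ E) ∧
      ∀ A : Fin (ℓ + 1) → Set X, (∀ j, MeasurableSet (A j)) →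
        HasRLim (fun α : Set.powersetCard ℕ m =>
          multiCorrelation μ A (fun j => sumAlong (g j) α)) (∏ j, μ.real (A j)) := by
  obtain ⟨𝒜, h𝒜c, h𝒜⟩ := exists_countable_measureDense μ
  obtain ⟨Λ, hΛ, hpos⟩ := exists_folnerMean_pos hF hE
  have := isCountablyGenerated_mixFilter (G := G) (μ := μ) h𝒜c ℓ
  obtain ⟨D, hD⟩ := (mixFilter G μ 𝒜 ℓ).exists_antitone_basis
  choose x hxD hxE using fun k => hΛ.exists_mem_of_pos hpos
    (h.meanFilter_le_mixFilter hΛ h𝒜.measurable (hD.mem k))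
  have hsum : ∀ α : Set.powersetCard ℕ 1, ∃ k ∈ (α : Finset ℕ),
      (fun j => sumAlong (fun k (_ : Fin 1) => x k j) α) = x k := fun α =>
    ⟨_, Finset.orderEmbOfFin_mem _ (Set.powersetCard.card_eq α) 0, by simp [sumAlong]⟩
  refine ⟨1, one_pos, fun j k _ => x k j, fun α => ?_, fun A hA ε hε => ?_⟩
  · obtain ⟨k, -, hk⟩ := hsum α
    rw [hk]
    exact hxE k
  · have hlim := tendsto_multiCorrelation_of_measureDense h𝒜 (hD.tendsto hxD) hA
    obtain ⟨N, hN⟩ := Metric.tendsto_atTop.1 hlim ε hε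
    refine ⟨⟨{N}, by simp⟩, fun α hα => ?_⟩
    obtain ⟨k, hkα, hk⟩ := hsum α
    change dist (multiCorrelation μ A fun j => sumAlong (fun k (_ : Fin 1) => x k j) α) _ < ε
    rw [hk]
    exact hN k (hα N (by simp) k hkα).le

/-- All requirements besides membership in `E` are encoded in one countably generated filter `𝓛`
whose members have full mean, so the summands may be drawn from a base of `𝓛`. -/
theorem IsWeaklyMixing.exists_mixing_sums [Countable G] [Infinite G] [IsSeparable μ] (h : IsWeaklyMixing G μ)
    (hF : IsFolnerSeq F) (hE : 0 < upperDensity F E) {m : ℕ} (hm : 0 < m) :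
    ∃ g : Fin ℓ → ℕ → Fin m → G,
      (∀ j, NonDegenerated (g j)) ∧
      (∀ i j, i ≠ j → EssentiallyDistinct (g j) (g i)) ∧
      (∀ α : Set.powersetCard ℕ m, (fun j => sumAlong (g j) α) ∈ E) ∧
      (∀ t j, MixingProperty μ (fun k (x : X) => g j k t +ᵥ x)) ∧
      (∀ t i j, i ≠ j → MixingProperty μ (fun k (x : X) => (g j k t - g i k t) +ᵥ x)) := by
  obtain ⟨𝒜, h𝒜c, h𝒜⟩ := exists_countable_measureDense μ
  obtain ⟨Λ₀, hΛ₀, hpos₀⟩ := exists_folnerMean_pos hF hE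
  obtain ⟨Λ, hext, hle⟩ := exists_isExtremeMean_le hΛ₀ (ind E)
  have hΛ := hext.isInvMean
  have := isCountablyGenerated_mixInftyFilter (G := G) (μ := μ) h𝒜c
  let 𝓛 : Filter (Fin ℓ → G) := (⨅ j, comap (fun g => g j) (mixInftyFilter G μ 𝒜)) ⊓
    ⨅ i, ⨅ j, ⨅ _ : i ≠ j, comap (fun g => g j - g i) (mixInftyFilter G μ 𝒜)
  have hΛ𝓛 : hΛ.meanFilter ≤ 𝓛 := by
    refine le_inf (le_iInf fun j => tendsto_iff_comap.1 ?_)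
      (le_iInf fun i => le_iInf fun j => le_iInf fun hij => tendsto_iff_comap.1 ?_)
    · exact h.tendsto_mixInftyFilter hΛ h𝒜.measurable
        (Pi.evalAddMonoidHom (fun _ : Fin ℓ => G) j) (Function.surjective_eval j)
    · exact h.tendsto_mixInftyFilter hΛ h𝒜.measurable _ (surjective_eval_sub hij)
  obtain ⟨D, hD⟩ := 𝓛.exists_antitone_basis
  obtain ⟨x, hxD, hxE⟩ := hext.exists_seq_sum_mem (hpos₀.trans_le hle)
    (fun k => hΛ𝓛 (hD.mem k)) hm
  have hx : ∀ t, Tendsto (fun k => x k t) atTop 𝓛 := fun t => hD.tendsto fun k => hxD k t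
  have h1 : ∀ t j, Tendsto (fun k => x k t j) atTop (mixInftyFilter G μ 𝒜) := fun t j =>
    tendsto_comap_iff.1 (tendsto_iInf.1 (tendsto_inf.1 (hx t)).1 j)
  have h2 : ∀ t i j, i ≠ j → Tendsto (fun k => x k t j - x k t i) atTop (mixInftyFilter G μ 𝒜) :=
    fun t i j hij => tendsto_comap_iff.1
      (tendsto_iInf.1 (tendsto_iInf.1 (tendsto_iInf.1 (tendsto_inf.1 (hx t)).2 i) j) hij)
  refine ⟨fun j k t => x k t j, fun j t => (tendsto_inf.1 (h1 t j)).1,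
    fun i j hij t => (tendsto_inf.1 (h2 t i j hij)).1, fun α => ?_, fun t j => ?_,
    fun t i j hij => ?_⟩
  · convert hxE _ ((α : Finset ℕ).orderEmbOfFin (Set.powersetCard.card_eq α)).strictMono using 1
    funext j
    simp [sumAlong, Finset.sum_apply]
  · exact mixingProperty_of_tendsto h𝒜 (tendsto_comap_iff.1 (tendsto_inf.1 (h1 t j)).2)
  · exact mixingProperty_of_tendsto h𝒜 (tendsto_comap_iff.1 (tendsto_inf.1 (h2 t i j hij)).2)

end Forward
-- Recovering weak mixing
section Backward

variable {G : Type*} [AddCommGroup G] {ι : Type*} {l : Filter ι}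

section General
variable {Y : Type*} [MeasurableSpace Y] [AddAction G Y] {ν : Measure Y}
  [VAddInvariantMeasure G Y ν]

theorem measureReal_vadd_set (g : G) (S : Set Y) : ν.real (g +ᵥ S) = ν.real S := by
  simp [measureReal_def, measure_vadd]

theorem measureReal_inter_neg_vadd (g : G) (S S' : Set Y) :
    ν.real (S ∩ (-g +ᵥ S')) = ν.real (S' ∩ (g +ᵥ S)) := by
  rw [← measureReal_vadd_set g (S ∩ _), Set.vadd_set_inter, vadd_neg_vadd, Set.inter_comm]

variable [IsProbabilityMeasure ν]

/-- For an invariant set the correlations are constantly `ν S`, so `ν S = ν S ^ 2`. -/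
theorem ergodicVAdd_of_tendsto [l.NeBot] {γ : ι → G}
    (h : ∀ S : Set Y, MeasurableSet S →
      Tendsto (fun i => ν.real (S ∩ (γ i +ᵥ S))) l (𝓝 (ν.real S * ν.real S))) :
    ErgodicVAdd G Y ν where
  aeconst_of_forall_preimage_vadd_ae_eq {s} hs hinv := by
    have hconst : ∀ i, ν.real (s ∩ (γ i +ᵥ s)) = ν.real s := fun i => by
      have h1 := hinv (-γ i)
      rw [Set.preimage_vadd, neg_neg] at h1
      have h2 : (s ∩ (γ i +ᵥ s) : Set Y) =ᵐ[ν] s := by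
        simpa using (ae_eq_refl s).inter h1
      exact measureReal_congr h2
    have heq := tendsto_nhds_unique (h s hs)
      ((tendsto_const_nhds (x := ν.real s)).congr fun i => (hconst i).symm)
    rw [eventuallyConst_set']
    have : ν.real s * (ν.real s - 1) = 0 := by linarith
    rcases mul_eq_zero.1 this with h0 | h1
    · exact Or.inl (ae_eq_empty.2 ((measureReal_eq_zero_iff).1 h0))
    · refine Or.inr (eventuallyEq_univ.2 (mem_ae_iff.2 ?_))
      rw [← measureReal_eq_zero_iff, probReal_compl_eq_one_sub hs]
      linarith

variable [MeasurableConstVAdd G Y]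

/-- Mixing against a set `S` along a filter extends from a generating π-system to all measurable
sets. -/
theorem tendsto_inter_vadd_of_piSystem {𝒞 : Set (Set Y)}
    (hgen : ‹MeasurableSpace Y› = MeasurableSpace.generateFrom 𝒞) (hpi : IsPiSystem 𝒞)
    (γ : ι → G) {S : Set Y} (hS : MeasurableSet S)
    (h : ∀ S' ∈ 𝒞, Tendsto (fun i => ν.real (S ∩ (γ i +ᵥ S'))) l (𝓝 (ν.real S * ν.real S')))
    {S' : Set Y} (hS' : MeasurableSet S') :
    Tendsto (fun i => ν.real (S ∩ (γ i +ᵥ S'))) l (𝓝 (ν.real S * ν.real S')) := by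
  induction S', hS' using MeasurableSpace.induction_on_inter hgen hpi with
  | empty => simp [tendsto_const_nhds]
  | basic t ht => exact h t ht
  | compl t ht ih =>
    have h1 : ν.real S * ν.real tᶜ = ν.real S - ν.real S * ν.real t := by
      rw [probReal_compl_eq_one_sub ht]
      ring
    rw [h1]
    refine (ih.const_sub _).congr fun i => ?_
    rw [Set.vadd_set_compl, ← Set.sdiff_eq]
    have := measureReal_inter_add_sdiff (μ := ν) (s := S) (ht.const_vadd (γ i))
    linarith
  | iUnion f hd hf ih =>
    have hreal : ∀ t : ℕ → Set Y, (∀ k, MeasurableSet (t k)) →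
        Pairwise (Function.onFun Disjoint t) → ν.real (⋃ k, t k) = ∑' k, ν.real (t k) :=
      fun t ht htd => by
        rw [measureReal_def, measure_iUnion htd ht, ENNReal.tsum_toReal_eq fun k => measure_ne_top _ _]
        rfl
    have hsum : Summable fun k => ν.real (f k) :=
      ENNReal.summable_toReal (by rw [← measure_iUnion hd hf]; exact measure_ne_top _ _)
    rw [hreal f hf hd, ← tsum_mul_left]
    refine (tendsto_tsum_of_dominated_convergence hsum ih (Eventually.of_forall fun i k => ?_)).congr
      fun i => ?_
    · rw [Real.norm_of_nonneg measureReal_nonneg, ← measureReal_vadd_set (γ i) (f k)]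
      exact measureReal_mono Set.inter_subset_right
    · rw [Set.vadd_set_iUnion, Set.inter_iUnion, hreal _ fun k => hS.inter ((hf k).const_vadd _)]
      exact fun a b hab => (Set.disjoint_vadd_set.2 (hd hab)).mono Set.inter_subset_right
        Set.inter_subset_right

end General

variable {X : Type*} [MeasurableSpace X] [AddAction G X] [MeasurableConstVAdd G X] {μ : Measure X}
  [IsProbabilityMeasure μ] [VAddInvariantMeasure G X μ]

/-- An action is weakly mixing if it mixes all pairs of sets along some proper filter. -/
theorem isWeaklyMixing_of_tendsto [l.NeBot] {γ : ι → G}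
    (h : ∀ A₀ A₁ : Set X, MeasurableSet A₀ → MeasurableSet A₁ →
      Tendsto (fun i => μ.real (A₀ ∩ (γ i +ᵥ A₁))) l (𝓝 (μ.real A₀ * μ.real A₁))) :
    IsWeaklyMixing G μ := by
  have hinv : VAddInvariantMeasure G (X × X) (μ.prod μ) :=
    ⟨fun g s hs => ((measurePreserving_vadd g μ).prod
      (measurePreserving_vadd g μ)).measure_preimage hs.nullMeasurableSet⟩
  -- The π-λ extension varies only the translated set. Passing to inverses swaps the two roles, so
  -- mixing along `-γ` is needed as well.
  have hneg : ∀ A₀ A₁ : Set X, MeasurableSet A₀ → MeasurableSet A₁ →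
      Tendsto (fun i => μ.real (A₀ ∩ (-γ i +ᵥ A₁))) l (𝓝 (μ.real A₀ * μ.real A₁)) :=
    fun A₀ A₁ h₀ h₁ => by
      simp only [measureReal_inter_neg_vadd]
      rw [mul_comm]
      exact h A₁ A₀ h₁ h₀
  have hrect : ∀ γ : ι → G, (∀ A₀ A₁ : Set X, MeasurableSet A₀ → MeasurableSet A₁ →
      Tendsto (fun i => μ.real (A₀ ∩ (γ i +ᵥ A₁))) l (𝓝 (μ.real A₀ * μ.real A₁))) →
      ∀ A₀ B₀ A₁ B₁ : Set X, MeasurableSet A₀ → MeasurableSet B₀ → MeasurableSet A₁ →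
      MeasurableSet B₁ → Tendsto (fun i => (μ.prod μ).real ((A₀ ×ˢ B₀) ∩ (γ i +ᵥ (A₁ ×ˢ B₁)))) l
        (𝓝 ((μ.prod μ).real (A₀ ×ˢ B₀) * (μ.prod μ).real (A₁ ×ˢ B₁))) := by
    intro γ h A₀ B₀ A₁ B₁ hA₀ hB₀ hA₁ hB₁
    simp only [vadd_prod_set, Set.prod_inter_prod, measureReal_prod_prod]
    rw [mul_mul_mul_comm]
    exact (h A₀ A₁ hA₀ hA₁).mul (h B₀ B₁ hB₀ hB₁)
  have hgen := generateFrom_prod (α := X) (β := X).symm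
  refine ergodicVAdd_of_tendsto (l := l) (γ := γ) fun S hS => ?_
  refine tendsto_inter_vadd_of_piSystem hgen isPiSystem_prod γ hS ?_ hS
  rintro _ ⟨A₁, hA₁, B₁, hB₁, rfl⟩
  have hA₁ : MeasurableSet A₁ := hA₁
  have hB₁ : MeasurableSet B₁ := hB₁
  have key := tendsto_inter_vadd_of_piSystem (ν := μ.prod μ) (l := l) hgen isPiSystem_prod
    (fun i => -γ i) (hA₁.prod hB₁) (fun S' hS' => by
      obtain ⟨A₀, hA₀, B₀, hB₀, rfl⟩ := hS'
      exact hrect _ hneg A₁ B₁ A₀ B₀ hA₁ hB₁ hA₀ hB₀) hS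
  simp only [measureReal_inter_neg_vadd] at key
  rwa [mul_comm]

theorem isWeaklyMixing_of_mixingProperty {γ : ℕ → G}
    (h : MixingProperty μ fun k (x : X) => γ k +ᵥ x) : IsWeaklyMixing G μ := by
  refine isWeaklyMixing_of_tendsto (l := atTop) (γ := fun k => -γ k) fun A₀ A₁ h₀ h₁ => ?_
  simpa only [Set.preimage_vadd] using h A₀ A₁ h₀ h₁

theorem isWeaklyMixing_of_tendsto_multiCorrelation [l.NeBot] {ℓ : ℕ} (hℓ : 0 < ℓ)
    {γ : ι → Fin ℓ → G} (h : ∀ A : Fin (ℓ + 1) → Set X, (∀ j, MeasurableSet (A j)) →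
      Tendsto (fun i => multiCorrelation μ A (γ i)) l (𝓝 (∏ j, μ.real (A j)))) :
    IsWeaklyMixing G μ := by
  obtain ⟨ℓ, rfl⟩ := Nat.exists_eq_succ_of_ne_zero hℓ.ne'
  refine isWeaklyMixing_of_tendsto (l := l) (γ := fun i => γ i 0) fun A₀ A₁ h₀ h₁ => ?_
  let A : Fin (ℓ + 1 + 1) → Set X := Fin.cons A₀ (Fin.cons A₁ fun _ => Set.univ)
  have hA : ∀ j, MeasurableSet (A j) := by
    refine Fin.cases h₀ (Fin.cases h₁ fun _ => ?_)
    exact MeasurableSet.univ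
  have := h A hA
  simp only [Fin.prod_univ_succ, A, Fin.cons_zero, Fin.cons_succ, probReal_univ,
    Finset.prod_const_one, mul_one] at this
  refine this.congr fun i => ?_
  have hset : ⋂ j : Fin (ℓ + 1), (γ i j +ᵥ A j.succ) = γ i 0 +ᵥ A₁ := by
    ext x
    rw [Set.mem_iInter, Fin.forall_fin_succ]
    simp [A]
  change μ.real (A 0 ∩ ⋂ j : Fin (ℓ + 1), (γ i j +ᵥ A j.succ)) = _
  rw [hset]
  rfl

/-- The blocks `{n, …, n + m - 1}` eventually lie beyond any given `α₀`. -/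
theorem tendsto_of_hasRLim {Z : Type*} [PseudoMetricSpace Z] {m : ℕ}
    {x : Set.powersetCard ℕ m → Z} {a : Z} (h : HasRLim x a) :
    Tendsto (fun n => x ⟨(Finset.range m).map (addRightEmbedding n), by simp⟩) atTop (𝓝 a) := by
  refine Metric.tendsto_atTop.2 fun ε hε => ?_
  obtain ⟨α₀, hα₀⟩ := h ε hε
  refine ⟨(α₀ : Finset ℕ).sup id + 1, fun n hn => hα₀ _ fun i hi k hk => ?_⟩
  obtain ⟨j, -, rfl⟩ := Finset.mem_map.1 hk
  have : i ≤ (α₀ : Finset ℕ).sup id := Finset.le_sup (f := id) hi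
  simp only [addRightEmbedding_apply]
  omega

/-- A single Følner mean is enough: sets of uniform density one have full mean, so its filter serves
as the mixing filter. -/
theorem isWeaklyMixing_of_hasUniformDensityOne [Countable G] {ℓ : ℕ} (hℓ : 0 < ℓ)
    (h : ∀ A : Fin (ℓ + 1) → Set X, (∀ j, MeasurableSet (A j)) →
      ∀ ε : ℝ, 0 < ε → HasUniformDensityOne (mixingSet G μ A ε)) : IsWeaklyMixing G μ := by
  obtain ⟨F, hF⟩ := exists_isFolnerSeq (Fin ℓ → G)
  have hU := Ultrafilter.of_le (atTop : Filter ℕ)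
  have hΛ := isInvMean_folnerMean hF hU
  refine isWeaklyMixing_of_tendsto_multiCorrelation (l := hΛ.meanFilter) hℓ (γ := id)
    fun A hA => Metric.tendsto_nhds.2 fun ε hε => (h A hA ε hε).mem_meanFilter hF hU

end Backward
end AbelianMixing
-- The equivalence
open AbelianMixing
theorem theorem6p2 {G X : Type*} [AddCommGroup G] [Countable G] [Infinite G]
    [MeasurableSpace X] (μ : Measure X) [IsProbabilityMeasure μ] [MeasureTheory.IsSeparable μ]
    [AddAction G X] [MeasurableConstVAdd G X] [VAddInvariantMeasure G X μ]
    (ℓ : ℕ) (hℓ : 0 < ℓ) :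
    List.TFAE [
      -- (i)
      IsWeaklyMixing G μ,
      -- (ii)
      ∀ F : ℕ → Finset (Fin ℓ → G), IsFolnerSeq F →
        ∀ E : Set (Fin ℓ → G), 0 < upperDensity F E →
        ∀ m : ℕ, 0 < m →
        ∃ g : Fin ℓ → ℕ → Fin m → G,
          (∀ j, NonDegenerated (g j)) ∧
          (∀ i j, i ≠ j → EssentiallyDistinct (g j) (g i)) ∧
          (∀ α : Set.powersetCard ℕ m, (fun j => sumAlong (g j) α) ∈ E) ∧
          (∀ t j, MixingProperty μ (fun k (x : X) => g j k t +ᵥ x)) ∧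
          (∀ t i j, i ≠ j → MixingProperty μ (fun k (x : X) => (g j k t - g i k t) +ᵥ x)),
      -- (iii)
      ∀ F : ℕ → Finset (Fin ℓ → G), IsFolnerSeq F →
        ∀ E : Set (Fin ℓ → G), 0 < upperDensity F E →
        ∃ m : ℕ, 0 < m ∧ ∃ g : Fin ℓ → ℕ → Fin m → G,
          (∀ α : Set.powersetCard ℕ m, (fun j => sumAlong (g j) α) ∈ E) ∧
          ∀ A : Fin (ℓ + 1) → Set X, (∀ j, MeasurableSet (A j)) →
            HasRLim (fun α : Set.powersetCard ℕ m =>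
              multiCorrelation μ A (fun j => sumAlong (g j) α)) (∏ j, μ.real (A j)),
      -- (iv)
      ∀ A : Fin (ℓ + 1) → Set X, (∀ j, MeasurableSet (A j)) →
        ∀ ε : ℝ, 0 < ε → HasUniformDensityOne (mixingSet G μ A ε)] := by
  obtain ⟨F, hF⟩ := exists_isFolnerSeq (Fin ℓ → G)
  -- The implications from (ii) and (iii) back to (i) only use `E = univ`.
  have hpos : 0 < upperDensity F Set.univ := upperDensity_univ hF ▸ one_pos
  tfae_have 1 → 2 := fun h F hF E hE m hm => h.exists_mixing_sums hF hE hm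
  tfae_have 1 → 3 := fun h F hF E hE => h.exists_hasRLim hF hE
  tfae_have 1 → 4 := fun h A hA ε hε => h.hasUniformDensityOne_mixingSet hA hε
  tfae_have 2 → 1 := fun h => by
    obtain ⟨g, -, -, -, hg, -⟩ := h F hF Set.univ hpos 1 one_pos
    exact isWeaklyMixing_of_mixingProperty (hg 0 ⟨0, hℓ⟩)
  tfae_have 3 → 1 := fun h => by
    obtain ⟨m, -, g, -, hg⟩ := h F hF Set.univ hpos
    exact isWeaklyMixing_of_tendsto_multiCorrelation hℓ fun A hA => tendsto_of_hasRLim (hg A hA)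
  tfae_have 4 → 1 := isWeaklyMixing_of_hasUniformDensityOne hℓ
  tfae_finish
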